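/- Let $(V,Y,\mathbf 1,\omega)$ be a vertex operator algebra over $\mathbb C$ ($\mathbb Z$-graded by $L(0)$-eigenvalues, with finite-dimensional weight spaces $V_{(n)}$ that vanish for $n$ sufficiently negative), write $Y(u,x)=\sum_{n\in\mathbb Z}u_nx^{-n-1}$ and $L(n)=\omega_{n+1}$, and let $g$ be an automorphism of $V$ (fixing $\mathbf 1$ and $\omega$), not necessarily of finite order or semisimple. Let $\mathbb I$ be the set of imaginary numbers (including $0$). For $a\in[0,1)+\mathbb I$ let $V^{[a+\mathbb Z]}$ be the generalized eigenspace of $g$ with eigenvalue $e^{2\pi i a}$, and let $P(V)=\{a\in[0,1)+\mathbb I: V^{[a+\mathbb Z]}\neq 0\}$. Let $g=\sigma g_u$ be the multiplicative Jordan–Chevalley decomposition ($\sigma=e^{2\pi i a}$ on $V^{[a+\mathbb Z]}$, $g_u$ locally unipotent) and $\mathcal N=\frac1{2\pi i}\log g_u=\frac{1}{2\pi i}\sum_{j\ge1}\frac{(-1)^{j+1}}{j}(g_u-1)^j$. Let $\mathbf A_V$ act as $a$ on $V^{[a+\mathbb Z]}$, and let $\mathcal L$ act on $V_{(n)}\cap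 V^{[a+\mathbb Z]}$ as $n+a$ if $a\in\mathbb I$ and as $n+a-1$ if $a\notin\mathbb I$. For $u,v\in V$ put $$u\bullet_g v=\mathrm{Res}_y\,y^{-1}\,Y\Big((1+y)^{\mathcal L-L(0)+\mathcal N}u,\tfrac{1}{2\pi i}\log(1+y)\Big)v ,$$ let $\tilde O_g(V)\subset V$ be the span of the elements $$\mathrm{Res}_y\,y^{-n}\,Y\Big(y^{L(0)-\mathcal L+\mathbf A_V}(1+y)^{\mathcal L-L(0)+\mathcal N}u,\tfrac{1}{2\pi i}\log(1+y)\Big)v\qquad(n>1,\ u,v\in V),$$ and let $\tilde A_g(V)=V/\tilde O_g(V)$. **Theorem.** (1) The product $\bullet_g$ induces a bilinear product on $\tilde A_g(V)$, which makes $\tilde A_g(V)$ an associative algebra whose identity is the class of $\mathbf 1$. (2) For $a\in P(V)\cap\mathbb I$, $u\in V^{[a+\mathbb Z]}$ and $v\in V$: $\big((L(-1)+2\pi i(a+\mathcal N))u\big)\bullet_g v\in\tilde O_g(V)$. (3) For $a,b\in P(V)\cap\mathbb I$, $u\in V^{[a+\mathbb Z]}$ and $v\in V^{[b+\mathbb Z]}$: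 $$u\bullet_g v-v\bullet_g u\equiv 2\pi i\,\mathrm{Res}_x Y\big(e^{2\pi i x(a+\mathcal N)}u,x\big)v=2\pi i\sum_{j\ge0}\frac{(2\pi i)^j}{j!}\big((\mathcal N+a)^ju\big)_jv \pmod{\tilde O_g(V)} .$$ (4) In particular, for $b\in P(V)\cap\mathbb I$ and $v\in V^{[b+\mathbb Z]}$: $$\omega\bullet_g v-v\bullet_g\omega\equiv-(2\pi i)^2(b+\mathcal N)v \pmod{\tilde O_g(V)} .$$ Hence, writing $D(x)=[\omega]x-x[\omega]$ for the bracket with the class $[\omega]$ of $\omega$ in $\tilde A_g(V)$: for such $b$ and $v$ there is $k\ge 0$ with $(D+(2\pi i)^2b)^k[v]=0$; and for every $v\in\bigoplus_{b}V^{[b+\mathbb Z]}$, where $b$ runs through the $g$-weights that are not nonzero imaginary numbers (so for every $v\in V$, if $P(V)\cap\mathbb I\subseteq\{0\}$), there is $k\ge 0$ with $D^k[v]=0$. -/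

import Mathlib

noncomputable section

/-- The mode `uₙ` of `Y(u, x) = ∑ₙ uₙ x^{-n-1}`. Lower truncation is built into `VertexOperator`:
the values `Y(u, x) v` are Laurent series. -/
abbrev vertexMode {V : Type*} [AddCommGroup V] [Module ℂ V] (Y : V →ₗ[ℂ] VertexOperator ℂ V)
    (u : V) (n : ℤ) : Module.End ℂ V := VertexOperator.ncoeff (Y u) n

/-- A vertex operator algebra over `ℂ` with underlying vector space `V`. The Virasoro operators are
`L(n) = ω_{n+1}`, and the weight spaces `V_(n)` are the eigenspaces of `L(0) = ω_1`. -/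
structure VertexOperatorAlgebra (V : Type*) [AddCommGroup V] [Module ℂ V] where
  /-- the vertex operator map -/
  Y : V →ₗ[ℂ] VertexOperator ℂ V
  /-- the vacuum -/
  vacuum : V
  /-- the conformal element -/
  conformal : V
  /-- the central charge -/
  centralCharge : ℂ
  /-- `V` is the direct sum of the weight spaces `V_(n)`, `n ∈ ℤ` -/
  isInternal_weight : DirectSum.IsInternal
    fun n : ℤ => Module.End.eigenspace (vertexMode Y conformal 1) (n : ℂ)
  finiteDimensional_weight : ∀ n : ℤ,
    FiniteDimensional ℂ (Module.End.eigenspace (vertexMode Y conformal 1) (n : ℂ))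
  weight_eq_bot : ∃ n₀ : ℤ, ∀ n : ℤ, n < n₀ →
    Module.End.eigenspace (vertexMode Y conformal 1) (n : ℂ) = ⊥
  vacuum_mode : ∀ (n : ℤ) (v : V), vertexMode Y vacuum n v = if n = -1 then v else 0
  mode_vacuum : ∀ (n : ℕ) (u : V), vertexMode Y u (n : ℤ) vacuum = 0
  creation : ∀ u : V, vertexMode Y u (-1) vacuum = u
  /-- the Jacobi identity, in components; all three sums are finite by lower truncation -/
  jacobi : ∀ (u v w : V) (l m n : ℤ),
    ∑ᶠ i : ℕ, ((Ring.choose m i : ℤ) : ℂ) •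
        vertexMode Y (vertexMode Y u (l + i) v) (m + n - i) w =
      (∑ᶠ i : ℕ, ((-1 : ℂ) ^ i * ((Ring.choose l i : ℤ) : ℂ)) •
        vertexMode Y u (m + l - i) (vertexMode Y v (n + i) w)) -
      ∑ᶠ i : ℕ, ((-1 : ℂ) ^ i * (-1 : ℂ) ^ l * ((Ring.choose l i : ℤ) : ℂ)) •
        vertexMode Y v (n + l - i) (vertexMode Y u (m + i) w)
  virasoro : ∀ (m n : ℤ) (v : V),
    vertexMode Y conformal (m + 1) (vertexMode Y conformal (n + 1) v) -
      vertexMode Y conformal (n + 1) (vertexMode Y conformal (m + 1) v) =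
      ((m : ℂ) - n) • vertexMode Y conformal (m + n + 1) v +
        (if m + n = 0 then (((m : ℂ) ^ 3 - m) / 12 * centralCharge) • v else 0)
  /-- the `L(-1)`-derivative property `Y(L(-1)u, x) = d/dx Y(u, x)` -/
  derivative : ∀ (u v : V) (n : ℤ),
    vertexMode Y (vertexMode Y conformal 0 u) n v = (-(n : ℂ)) • vertexMode Y u (n - 1) v

namespace VertexOperatorAlgebra

variable {V : Type*} [AddCommGroup V] [Module ℂ V]

/-- The Virasoro operator `L(n) = ω_{n+1}`. -/
def L (A : VertexOperatorAlgebra V) (n : ℤ) : Module.End ℂ V :=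
  vertexMode A.Y A.conformal (n + 1)

/-- For a formal power series `c(y) = ∑ⱼ cⱼ yʲ` with coefficients in `V` and a Laurent series `s(y)`
with zero constant term and nonzero linear term, this is the coefficient of `y^k` in
`Y(c(y), s(y)) v = ∑ₙ ∑ⱼ (cⱼ)ₙ v yʲ s(y)^{-n-1}`. -/
def coeffY (A : VertexOperatorAlgebra V) (c : ℕ → V) (s : LaurentSeries ℂ) (v : V) (k : ℤ) : V :=
  ∑ᶠ p : ℤ × ℕ, (s ^ (-p.1 - 1)).coeff (k - p.2) • vertexMode A.Y (c p.2) p.1 v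

/-- An automorphism of a vertex operator algebra. -/
structure Automorphism (A : VertexOperatorAlgebra V) where
  toLinearEquiv : V ≃ₗ[ℂ] V
  map_vacuum : toLinearEquiv A.vacuum = A.vacuum
  map_conformal : toLinearEquiv A.conformal = A.conformal
  map_mode : ∀ (u v : V) (n : ℤ),
    toLinearEquiv (vertexMode A.Y u n v) =
      vertexMode A.Y (toLinearEquiv u) n (toLinearEquiv v)

end VertexOperatorAlgebra

/-- The Laurent series `log(1+y) / (2πi)`. -/
def logDivTwoPiI : LaurentSeries ℂ :=
  (2 * Real.pi * Complex.I)⁻¹ • ((PowerSeries.log ℂ : PowerSeries ℂ) : LaurentSeries ℂ)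

/-- The coefficients of `(1+y)^T u = ∑ⱼ binom(T, j) u yʲ` for a linear operator `T`, where
`binom(T, j) = T (T - 1) ⋯ (T - j + 1) / j!`. -/
def onePlusPow {V : Type*} [AddCommGroup V] [Module ℂ V] (T : Module.End ℂ V) (u : V) (j : ℕ) : V :=
  ((j.factorial : ℂ)⁻¹) • (Polynomial.aeval T (descPochhammer ℂ j)) u

/-- The coefficients of `e^{xT} u = ∑ⱼ Tʲ u xʲ / j!` for a linear operator `T`. -/
def expCoeff {V : Type*} [AddCommGroup V] [Module ℂ V] (T : Module.End ℂ V) (u : V) (j : ℕ) : V :=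
  ((j.factorial : ℂ)⁻¹) • (T ^ j) u

/-- `log(1 + M) = ∑_{j ≥ 1} (-1)^{j+1} Mʲ / j` for a locally nilpotent operator `M`. -/
def logOnePlus {V : Type*} [AddCommGroup V] [Module ℂ V] (M : Module.End ℂ V)
    (hM : ∀ v, ∃ j : ℕ, (M ^ j) v = 0) : Module.End ℂ V :=
  have key : ∀ v, (Function.support fun j : ℕ =>
      ((-1 : ℂ) ^ j / ((j : ℂ) + 1)) • (M ^ (j + 1)) v).Finite := by
    intro v
    obtain ⟨k, hk⟩ := hM v
    refine (Set.finite_lt_nat k).subset fun j hj => ?_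
    by_contra hjk
    refine hj ?_
    have h : k ≤ j + 1 := by simp at hjk; omega
    have : (M ^ (j + 1)) v = 0 := by
      rw [← Nat.sub_add_cancel h, pow_add, Module.End.mul_apply, hk, map_zero]
    simp [this]
  { toFun := fun v => ∑ᶠ j : ℕ, ((-1 : ℂ) ^ j / ((j : ℂ) + 1)) • (M ^ (j + 1)) v
    map_add' := fun v w => by
      simp only [map_add, smul_add]
      exact finsum_add_distrib (key v) (key w)
    map_smul' := fun r v => by
      simp only [map_smul, RingHom.id_apply]
      rw [smul_finsum]
      exact finsum_congr fun j => smul_comm _ _ _ }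

/-- The strip `[0, 1) + 𝕀` of complex numbers with real part in `[0, 1)`: a set of representatives
of `ℂ / ℤ`. -/
abbrev Strip : Type := {a : ℂ // 0 ≤ a.re ∧ a.re < 1}

theorem Strip.exp_injective :
    Function.Injective fun a : Strip => Complex.exp (2 * Real.pi * Complex.I * a) := by
  rintro ⟨a, ha⟩ ⟨b, hb⟩ h
  obtain ⟨n, hn⟩ := Complex.exp_eq_exp_iff_exists_int.1 h
  have h0 : (2 * Real.pi * Complex.I : ℂ) ≠ 0 := Complex.two_pi_I_ne_zero
  have h1 : a = b + n := by
    apply mul_left_cancel₀ h0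
    simp only at hn
    rw [hn]; ring
  have h2 : a.re = b.re + n := by simp [h1]
  have h3 : (n : ℝ) < 1 := by linarith [ha.2, hb.1]
  have h4 : (-1 : ℝ) < n := by linarith [ha.1, hb.2]
  have h5 : n = 0 := by
    have : n < 1 := by exact_mod_cast h3
    have : -1 < n := by exact_mod_cast h4
    omega
  subst h5
  exact Subtype.ext (by simpa using h1)

theorem Strip.exists_exp_eq {z : ℂ} (hz : z ≠ 0) :
    ∃ a : Strip, Complex.exp (2 * Real.pi * Complex.I * a) = z := by
  have h0 : (2 * Real.pi * Complex.I : ℂ) ≠ 0 := Complex.two_pi_I_ne_zero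
  set b : ℂ := Complex.log z / (2 * Real.pi * Complex.I) with hb
  refine ⟨⟨b - (⌊b.re⌋ : ℤ), ?_, ?_⟩, ?_⟩
  · simp
  · simp only [Complex.sub_re, Complex.intCast_re]
    linarith [Int.lt_floor_add_one b.re]
  · have : 2 * Real.pi * Complex.I * (b - (⌊b.re⌋ : ℤ)) =
        Complex.log z - (⌊b.re⌋ : ℤ) * (2 * Real.pi * Complex.I) := by
      rw [hb]; field_simp
    simp only
    rw [this, Complex.exp_sub, Complex.exp_int_mul_two_pi_mul_I, Complex.exp_log hz, div_one]

namespace VertexOperatorAlgebra.Automorphism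

variable {V : Type*} [AddCommGroup V] [Module ℂ V] {A : VertexOperatorAlgebra V}

/-- The automorphism as a linear operator on `V`. -/
def op (g : A.Automorphism) : Module.End ℂ V := g.toLinearEquiv.toLinearMap

/-- `V^{[a + ℤ]}`, the generalized eigenspace of `g` for the eigenvalue `e^{2πia}`. -/
def genSpace (g : A.Automorphism) (a : ℂ) : Submodule ℂ V :=
  Module.End.maxGenEigenspace g.op (Complex.exp (2 * Real.pi * Complex.I * a))

/-- `P(V)`, the set of `g`-weights of `V`. -/
def weights (g : A.Automorphism) : Set ℂ :=
  {a | 0 ≤ a.re ∧ a.re < 1 ∧ g.genSpace a ≠ ⊥}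

theorem iSup_maxGenEigenspace (g : A.Automorphism) :
    ⨆ μ : ℂ, Module.End.maxGenEigenspace g.op μ = ⊤ := by
  rw [eq_top_iff, ← A.isInternal_weight.submodule_iSup_eq_top]
  refine iSup_le fun n => ?_
  set W := Module.End.eigenspace (vertexMode A.Y A.conformal 1) (n : ℂ) with hW
  have hmap : ∀ x ∈ W, g.op x ∈ W := by
    intro x hx
    rw [hW, Module.End.mem_eigenspace_iff] at hx ⊢
    have := g.map_mode A.conformal x 1
    rw [hx, g.map_conformal, map_smul] at this
    exact this.symm
  have := A.finiteDimensional_weight n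
  have htop := Module.End.iSup_maxGenEigenspace_eq_top (g.op.restrict hmap)
  have h2 : W = Submodule.map W.subtype
      (⨆ μ : ℂ, Module.End.maxGenEigenspace (g.op.restrict hmap) μ) := by
    rw [htop, Submodule.map_top, Submodule.range_subtype]
  rw [h2, Submodule.map_iSup]
  refine iSup_mono fun μ => ?_
  rintro _ ⟨x, hx, rfl⟩
  rw [SetLike.mem_coe, Module.End.mem_maxGenEigenspace] at hx
  obtain ⟨k, hk⟩ := hx
  rw [Module.End.mem_maxGenEigenspace]
  refine ⟨k, ?_⟩
  have h3 : ∀ (k : ℕ) (x : W), (((g.op.restrict hmap - μ • (1 : Module.End ℂ W)) ^ k) x : V) =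
      ((g.op - μ • (1 : Module.End ℂ V)) ^ k) x := by
    intro k
    induction k with
    | zero => intro x; simp
    | succ k ih =>
      intro x
      rw [pow_succ, pow_succ, Module.End.mul_apply, Module.End.mul_apply, ih]
      rfl
  rw [Submodule.subtype_apply, ← h3, hk]
  rfl

/-- `V` is the direct sum of the generalized eigenspaces `V^{[a + ℤ]}`, `a ∈ [0, 1) + 𝕀`. -/
theorem isInternal_genSpace (g : A.Automorphism) :
    DirectSum.IsInternal fun a : Strip => g.genSpace a := by
  refine (DirectSum.isInternal_submodule_iff_iSupIndep_and_iSup_eq_top _).2 ⟨?_, ?_⟩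
  · exact (Module.End.independent_maxGenEigenspace g.op).comp Strip.exp_injective
  · rw [eq_top_iff, ← g.iSup_maxGenEigenspace]
    refine iSup_le fun μ => ?_
    by_cases hμ : μ = 0
    · subst hμ
      intro x hx
      rw [Module.End.mem_maxGenEigenspace] at hx
      obtain ⟨k, hk⟩ := hx
      have hinj : Function.Injective ((g.op - (0 : ℂ) • (1 : Module.End ℂ V)) ^ k) := by
        rw [zero_smul, sub_zero, Module.End.coe_pow]
        exact Function.Injective.iterate g.toLinearEquiv.injective k
      rw [hinj (hk.trans (map_zero _).symm)]
      exact zero_mem _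
    · obtain ⟨a, ha⟩ := Strip.exists_exp_eq hμ
      refine le_trans ?_ (le_iSup (fun a : Strip => g.genSpace a) a)
      rw [← ha]
      exact le_rfl

/-- The isomorphism from the external direct sum of the spaces `V^{[a + ℤ]}` to `V`. -/
def decompEquiv (g : A.Automorphism) :
    (DirectSum Strip fun a : Strip => g.genSpace a) ≃ₗ[ℂ] V :=
  LinearEquiv.ofBijective (DirectSum.coeLinearMap fun a : Strip => g.genSpace a)
    g.isInternal_genSpace

/-- The linear operator on `V` acting as the scalar `f a` on `V^{[a + ℤ]}`, `a ∈ [0, 1) + 𝕀`. -/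
def scalarOp (g : A.Automorphism) (f : Strip → ℂ) : Module.End ℂ V :=
  (DirectSum.toModule ℂ Strip V fun a => f a • (g.genSpace a).subtype) ∘ₗ
    g.decompEquiv.symm.toLinearMap

theorem scalarOp_apply (g : A.Automorphism) (f : Strip → ℂ) (a : Strip) {v : V}
    (hv : v ∈ g.genSpace a) : g.scalarOp f v = f a • v := by
  have h : g.decompEquiv.symm v =
      DirectSum.lof ℂ Strip (fun a : Strip => g.genSpace a) a ⟨v, hv⟩ := by
    rw [LinearEquiv.symm_apply_eq]
    exact (DirectSum.coeLinearMap_lof (fun a : Strip => g.genSpace a) a ⟨v, hv⟩).symm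
  rw [scalarOp, LinearMap.comp_apply, LinearEquiv.coe_coe, h, DirectSum.toModule_lof]
  rfl

/-- The operator `𝐀_V`, acting as `a` on `V^{[a + ℤ]}`. -/
def weightOp (g : A.Automorphism) : Module.End ℂ V := g.scalarOp fun a => (a : ℂ)

/-- The operator `𝓛`: on homogeneous `u ∈ V^{[a + ℤ]}` it acts as the scalar `l(u)`, which is
`wt u + a` if `a` is imaginary and `wt u + a - 1` if `0 < Re a < 1`. -/
def ellOp (g : A.Automorphism) : Module.End ℂ V :=
  A.L 0 + g.scalarOp fun a => if (a : ℂ).re = 0 then (a : ℂ) else (a : ℂ) - 1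

/-- The semisimple part `σ` of `g`, acting as `e^{2πia}` on `V^{[a + ℤ]}`. -/
def semisimplePart (g : A.Automorphism) : Module.End ℂ V :=
  g.scalarOp fun a => Complex.exp (2 * Real.pi * Complex.I * a)

/-- The locally unipotent part `g_u = σ⁻¹ g` of `g`. -/
def unipotentPart (g : A.Automorphism) : Module.End ℂ V :=
  (g.scalarOp fun a => (Complex.exp (2 * Real.pi * Complex.I * a))⁻¹) * g.op

theorem op_mem_genSpace (g : A.Automorphism) (a : ℂ) {v : V} (hv : v ∈ g.genSpace a) :
    g.op v ∈ g.genSpace a :=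
  Module.End.mapsTo_maxGenEigenspace_of_comm (Commute.refl g.op) _ hv

/-- `g = σ g_u`. -/
theorem semisimplePart_mul_unipotentPart (g : A.Automorphism) :
    g.semisimplePart * g.unipotentPart = g.op := by
  ext v
  have hv : v ∈ ⨆ a : Strip, g.genSpace a := by
    rw [g.isInternal_genSpace.submodule_iSup_eq_top]; trivial
  induction hv using Submodule.iSup_induction' with
  | mem a x hx =>
    have h := g.op_mem_genSpace a hx
    simp only [semisimplePart, unipotentPart, Module.End.mul_apply]
    rw [g.scalarOp_apply _ a h, map_smul, g.scalarOp_apply _ a h, smul_smul,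
      inv_mul_cancel₀ (Complex.exp_ne_zero _), one_smul]
  | zero => simp
  | add x y _ _ hx hy => rw [map_add, map_add, hx, hy]

/-- `g_u - 1` is locally nilpotent. -/
theorem unipotentPart_sub_one (g : A.Automorphism) (v : V) :
    ∃ j : ℕ, ((g.unipotentPart - 1) ^ j) v = 0 := by
  have hle : (⨆ a : Strip, g.genSpace a) ≤
      Module.End.maxGenEigenspace (g.unipotentPart - 1) 0 := by
    refine iSup_le fun a => ?_
    set z := Complex.exp (2 * Real.pi * Complex.I * a) with hz
    have hz0 : z ≠ 0 := Complex.exp_ne_zero _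
    have h1 : ∀ (k : ℕ), ∀ x ∈ g.genSpace a, ((g.unipotentPart - 1) ^ k) x =
        (z⁻¹) ^ k • ((g.op - z • (1 : Module.End ℂ V)) ^ k) x := by
      intro k
      induction k with
      | zero => intro x _; simp
      | succ k ih =>
        intro x hx
        have h := g.op_mem_genSpace a hx
        have hy : (g.op - z • (1 : Module.End ℂ V)) x ∈ g.genSpace a :=
          Submodule.sub_mem _ h (Submodule.smul_mem _ _ hx)
        have h2 : (g.unipotentPart - 1) x = z⁻¹ • (g.op - z • (1 : Module.End ℂ V)) x := by
          simp only [unipotentPart, LinearMap.sub_apply, Module.End.mul_apply,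
            Module.End.one_apply, LinearMap.smul_apply]
          rw [g.scalarOp_apply _ a h, smul_sub, smul_smul, inv_mul_cancel₀ hz0, one_smul]
        rw [pow_succ, Module.End.mul_apply, h2, map_smul, ih _ hy, smul_smul, pow_succ (_ - _),
          Module.End.mul_apply, pow_succ, mul_comm]
    intro x hx
    have hx' := hx
    rw [genSpace, Module.End.mem_maxGenEigenspace] at hx'
    obtain ⟨k, hk⟩ := hx'
    rw [Module.End.mem_maxGenEigenspace]
    refine ⟨k, ?_⟩
    rw [zero_smul, sub_zero, h1 k x hx, hk, smul_zero]
  have hv : v ∈ Module.End.maxGenEigenspace (g.unipotentPart - 1) 0 := by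
    apply hle
    rw [g.isInternal_genSpace.submodule_iSup_eq_top]; trivial
  rw [Module.End.mem_maxGenEigenspace] at hv
  simpa using hv

/-- `𝓝 = log(g_u) / (2πi)`. -/
def nilOp (g : A.Automorphism) : Module.End ℂ V :=
  (2 * Real.pi * Complex.I : ℂ)⁻¹ • logOnePlus (g.unipotentPart - 1) g.unipotentPart_sub_one

/-- The coefficient of `y^k` in `Y((1+y)^{𝓛 - L(0) + 𝓝} u, log(1+y)/(2πi)) v`. -/
def twistedCoeff (g : A.Automorphism) (u v : V) (k : ℤ) : V :=
  A.coeffY (onePlusPow (g.ellOp - A.L 0 + g.nilOp) u) logDivTwoPiI v k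

/-- `u •_g v = Res_y y⁻¹ Y((1+y)^{𝓛 - L(0) + 𝓝} u, log(1+y)/(2πi)) v`. -/
def bullet (g : A.Automorphism) (u v : V) : V := g.twistedCoeff u v 0

/-- The span `Õ_g(V)` of the elements
`Res_y y^{-n} Y(y^{L(0) - 𝓛 + 𝐀_V} (1+y)^{𝓛 - L(0) + 𝓝} u, log(1+y)/(2πi)) v`, `n > 1`.
The operator `L(0) - 𝓛 + 𝐀_V` is diagonalizable with eigenvalues among `0, 1`, and commutes with
`𝓛 - L(0) + 𝓝`; so one may take `u` an eigenvector, with eigenvalue `d`, and then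
`y^{L(0) - 𝓛 + 𝐀_V}` contributes the factor `y^d`. -/
def tildeO (g : A.Automorphism) : Submodule ℂ V :=
  Submodule.span ℂ {x | ∃ (n d : ℤ) (u v : V), 1 < n ∧
    (A.L 0 - g.ellOp + g.weightOp) u = (d : ℂ) • u ∧ x = g.twistedCoeff u v (n - d - 1)}

/-- The quotient space `Ã_g(V) = V / Õ_g(V)`. -/
abbrev TildeA (g : A.Automorphism) : Type _ := V ⧸ g.tildeO

/-- `Res_x Y(e^{2πi x (a + 𝓝)} u, x) v`. -/
def resExp (g : A.Automorphism) (a : ℂ) (u v : V) : V :=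
  A.coeffY (expCoeff ((2 * Real.pi * Complex.I : ℂ) • (a • (1 : Module.End ℂ V) + g.nilOp)) u)
    (HahnSeries.single 1 1) v (-1)

end VertexOperatorAlgebra.Automorphism

end

/-!
Write `κ = 2πi` and `T = 𝓛 - L(0) + 𝓝`. In the coordinate `x = log(1+y)/κ` the products in question
are the coefficients `F_k(u, v)` of `yᵏ` in `Y(e^{κxT} u, x) v`: the product `•_g` is `F_0`, and
`Õ_g(V)` is spanned by all `F_k(u, v)` with `k ≥ 1`, and by those with `k = 0` where `u` belongs to
the part `V₁` of `V` with non-imaginary `g`-weights (`tildeO_le`). Let `V₀` be the part with imaginary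
weights, so that `V = V₀ + V₁`. As `u •_g 1 = u`, the space `V₁` lies in `Õ_g(V)`.

The operator `T` is a derivation on products with first factor in `V₀` (`twOp_mode`). The
contribution of `𝓝` is a derivation because it is the logarithm of the automorphism `g_u`
(`logOnePlus_apply_bilin`), and adding an imaginary number does not change the case distinction in
the definition of `𝓛`. Hence the modes of `Y(e^{κxT} u, x)` obey the usual commutator formula for
`u ∈ V₀` (`twMode_commutator`).

Everything follows from this commutator formula alone, without the formula for iterates. The left
multiplication `u •` is the residue of `Y(e^{κxT} u, x)` against `f(x) = κ e^{κx}/(e^{κx} - 1)`. In the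
coordinate `y` one has `f = κ(1 + y⁻¹)` and `d/dx = κ(1+y) d/dy`, so that the higher derivatives of
`f` are polynomials in `y⁻¹` without constant term (`sum_kernel_mul`). Consequently
`[u •, F_k(v, ·)] ≡ κ F_k(Res_u v, ·)` modulo products `F_{k'}` with `k' > k`
(`coeffMap_commutator_mem`), where `Res_u v = Res_x Y(e^{κxT} u, x) v` is a derivation of all the
`F_k` (`resMap_coeffMap`). It follows that `Õ_g(V)` is stable under `u •` and under `Res_u`.
Applying the commutator to the vacuum gives `u • v - v • u ≡ κ Res_u v` (`commutator_mem`), which is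
the commutator formula of the theorem. It also shows that right multiplication by `w ∈ V₀` is
`w • - κ Res_w` modulo `Õ_g(V)`. So `Õ_g(V)` is a two-sided ideal, and right multiplications commute
with left multiplications (`associator_mem`).

The statement on `L(-1) + κ(a + 𝓝)` is the derivative property in the coordinate `y`
(`twCoeff_derivative`). For `ω` one has `Res_ω = L(-1)`, so the last assertions combine the two and
use that `𝓝` is locally nilpotent.
-/

noncomputable section

/-! ### Laurent series in the coordinate `log(1+y)/(2πi)` -/

/-- The product of two Laurent series with known lower bounds for their supports, as a sum over an
explicit interval. -/
theorem LaurentSeries.coeff_mul_eq_sum_Icc {f g : LaurentSeries ℂ} {a b : ℤ}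
    (hf : ∀ j < a, f.coeff j = 0) (hg : ∀ j < b, g.coeff j = 0) (n : ℤ) :
    (f * g).coeff n = ∑ j ∈ Finset.Icc a (n - b), f.coeff j * g.coeff (n - j) := by
  rw [HahnSeries.coeff_mul]
  have hinj : Set.InjOn (Prod.fst : ℤ × ℤ → ℤ)
      (Finset.antidiagonal f.isPWO_support g.isPWO_support n) := by
    intro x hx y hy hxy
    simp only [Finset.mem_coe, Finset.mem_antidiagonal] at hx hy
    ext
    · exact hxy
    · have h1 := hx.2.2
      have h2 := hy.2.2
      omega
  have key : ∑ ij ∈ Finset.antidiagonal f.isPWO_support g.isPWO_support n,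
      f.coeff ij.fst * g.coeff ij.snd =
      ∑ ij ∈ Finset.antidiagonal f.isPWO_support g.isPWO_support n,
        (fun j => f.coeff j * g.coeff (n - j)) ij.fst := by
    refine Finset.sum_congr rfl fun x hx => ?_
    rw [Finset.mem_antidiagonal] at hx
    have : x.2 = n - x.1 := by omega
    simp only [this]
  rw [key, ← Finset.sum_image (f := fun j => f.coeff j * g.coeff (n - j)) hinj]
  refine Finset.sum_subset ?_ ?_
  · intro j hj
    rw [Finset.mem_image] at hj
    obtain ⟨x, hx, rfl⟩ := hj
    rw [Finset.mem_antidiagonal] at hx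
    have h1 : a ≤ x.1 := by
      by_contra h
      exact hx.1 (hf _ (by omega))
    have h2 : b ≤ x.2 := by
      by_contra h
      exact hx.2.1 (hg _ (by omega))
    rw [Finset.mem_Icc]
    omega
  · intro j _ hj
    by_contra h
    refine hj (Finset.mem_image.2 ⟨(j, n - j), ?_, rfl⟩)
    rw [Finset.mem_antidiagonal]
    exact ⟨left_ne_zero_of_mul h, right_ne_zero_of_mul h, by simp⟩

theorem LaurentSeries.coeff_mul_eq_zero {f g : LaurentSeries ℂ} {a b : ℤ}
    (hf : ∀ j < a, f.coeff j = 0) (hg : ∀ j < b, g.coeff j = 0) {n : ℤ} (hn : n < a + b) :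
    (f * g).coeff n = 0 := by
  rw [coeff_mul_eq_sum_Icc hf hg, Finset.Icc_eq_empty (by omega), Finset.sum_empty]

theorem LaurentSeries.coeff_mul_lowest {f g : LaurentSeries ℂ} {a b : ℤ}
    (hf : ∀ j < a, f.coeff j = 0) (hg : ∀ j < b, g.coeff j = 0) {n : ℤ} (hn : n = a + b) :
    (f * g).coeff n = f.coeff a * g.coeff b := by
  subst hn
  rw [coeff_mul_eq_sum_Icc hf hg, add_sub_cancel_right, Finset.Icc_self, Finset.sum_singleton,
    add_sub_cancel_left]

theorem LaurentSeries.exists_coeff_eq_zero (f : LaurentSeries ℂ) :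
    ∃ a : ℤ, ∀ j < a, f.coeff j = 0 :=
  ⟨f.order, fun _ hj => HahnSeries.coeff_eq_zero_of_lt_order hj⟩

/-- The Euler operator `y d/dy` on Laurent series. -/
def eulerOp : LaurentSeries ℂ →+ LaurentSeries ℂ where
  toFun := fun f =>
    { coeff := fun n => (n : ℂ) * f.coeff n
      isPWO_support' := f.isPWO_support.mono fun n hn h => hn (by simp [h]) }
  map_zero' := by ext n; simp
  map_add' := fun f g => by ext n; simp [mul_add]

@[simp]
theorem coeff_eulerOp (f : LaurentSeries ℂ) (n : ℤ) :
    (eulerOp f).coeff n = (n : ℂ) * f.coeff n := rfl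

theorem eulerOp_mul (f g : LaurentSeries ℂ) :
    eulerOp (f * g) = f * eulerOp g + g * eulerOp f := by
  obtain ⟨a, ha⟩ := LaurentSeries.exists_coeff_eq_zero f
  obtain ⟨b, hb⟩ := LaurentSeries.exists_coeff_eq_zero g
  ext n
  rw [HahnSeries.coeff_add, coeff_eulerOp,
    LaurentSeries.coeff_mul_eq_sum_Icc ha hb, mul_comm g,
    LaurentSeries.coeff_mul_eq_sum_Icc ha (b := b) (fun j hj => by simp [hb j hj]),
    LaurentSeries.coeff_mul_eq_sum_Icc (a := a) (fun j hj => by simp [ha j hj]) hb,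
    Finset.mul_sum, ← Finset.sum_add_distrib]
  refine Finset.sum_congr rfl fun j _ => ?_
  rw [coeff_eulerOp, coeff_eulerOp]
  push_cast
  ring

theorem eulerOp_zpow (f : LaurentSeries ℂ) (n : ℤ) :
    eulerOp (f ^ n) = n • (f ^ (n - 1) * eulerOp f) := by
  let _ : Algebra ℤ (LaurentSeries ℂ) := Ring.toIntAlgebra _
  let D : Derivation ℤ (LaurentSeries ℂ) (LaurentSeries ℂ) :=
    Derivation.mk' eulerOp.toIntLinearMap eulerOp_mul
  exact D.leibniz_zpow f n

/-- The constant `2πi`. -/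
def kappa : ℂ := 2 * Real.pi * Complex.I

theorem kappa_ne_zero : kappa ≠ 0 := Complex.two_pi_I_ne_zero

theorem coeff_logDivTwoPiI_of_lt {n : ℤ} (hn : n < 1) : logDivTwoPiI.coeff n = 0 := by
  rw [logDivTwoPiI, HahnSeries.coeff_smul]
  rcases lt_or_ge n 0 with h | h
  · rw [PowerSeries.coeff_coe, if_pos h, smul_zero]
  · obtain rfl : n = 0 := by omega
    simp [PowerSeries.coeff_coe]

theorem coeff_logDivTwoPiI_natCast (n : ℕ) :
    logDivTwoPiI.coeff n = kappa⁻¹ * PowerSeries.coeff n (PowerSeries.log ℂ) := by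
  rw [logDivTwoPiI, HahnSeries.coeff_smul, PowerSeries.coeff_coe, if_neg (by omega), smul_eq_mul]
  rfl

theorem coeff_logDivTwoPiI_one : logDivTwoPiI.coeff 1 = kappa⁻¹ := by
  have := coeff_logDivTwoPiI_natCast 1
  rw [Nat.cast_one] at this
  rw [this, PowerSeries.coeff_one_log, mul_one]

theorem logDivTwoPiI_ne_zero : logDivTwoPiI ≠ 0 := by
  intro h
  have := coeff_logDivTwoPiI_one
  rw [h, HahnSeries.coeff_zero] at this
  exact inv_ne_zero kappa_ne_zero this.symm

theorem order_logDivTwoPiI : logDivTwoPiI.order = 1 := by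
  refine le_antisymm (HahnSeries.order_le_of_coeff_ne_zero ?_) ?_
  · rw [coeff_logDivTwoPiI_one]
    exact inv_ne_zero kappa_ne_zero
  · by_contra h
    exact HahnSeries.coeff_order_eq_zero.not.2 logDivTwoPiI_ne_zero
      (coeff_logDivTwoPiI_of_lt (by omega))

theorem order_logDivTwoPiI_zpow (n : ℤ) : (logDivTwoPiI ^ n).order = n := by
  have hinv : (logDivTwoPiI⁻¹).order = -1 := by
    have := HahnSeries.order_mul logDivTwoPiI_ne_zero (inv_ne_zero logDivTwoPiI_ne_zero)
    rw [mul_inv_cancel₀ logDivTwoPiI_ne_zero, HahnSeries.order_one, order_logDivTwoPiI] at this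
    omega
  obtain ⟨m, rfl | rfl⟩ := n.eq_nat_or_neg
  · rw [zpow_natCast, HahnSeries.order_pow, order_logDivTwoPiI]; simp
  · rw [zpow_neg, zpow_natCast, ← inv_pow, HahnSeries.order_pow, hinv]; simp

theorem coeff_logDivTwoPiI_zpow_of_lt {n j : ℤ} (h : j < n) :
    (logDivTwoPiI ^ n).coeff j = 0 :=
  HahnSeries.coeff_eq_zero_of_lt_order (by rwa [order_logDivTwoPiI_zpow])

theorem coeff_logDivTwoPiI_zpow_self_ne_zero (n : ℤ) : (logDivTwoPiI ^ n).coeff n ≠ 0 := by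
  have h := HahnSeries.coeff_order_eq_zero.not.2 (zpow_ne_zero n logDivTwoPiI_ne_zero)
  rwa [order_logDivTwoPiI_zpow] at h

/-- `(1+y) y d/dy (log(1+y)/(2πi)) = y/(2πi)`. -/
theorem one_add_X_mul_euler_log :
    (1 + HahnSeries.single 1 1) * eulerOp logDivTwoPiI = HahnSeries.single 1 kappa⁻¹ := by
  ext n
  rw [add_mul, one_mul, HahnSeries.coeff_add, HahnSeries.coeff_single_mul, one_mul,
    coeff_eulerOp, coeff_eulerOp, HahnSeries.coeff_single]
  rcases lt_trichotomy n 1 with h | rfl | h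
  · rw [coeff_logDivTwoPiI_of_lt h, coeff_logDivTwoPiI_of_lt (by omega), if_neg (by omega)]; simp
  · rw [coeff_logDivTwoPiI_one]
    simp
  · obtain ⟨m, rfl⟩ : ∃ m : ℕ, n = ((m + 2 : ℕ) : ℤ) := ⟨(n - 2).toNat, by omega⟩
    have h1 : ((m + 2 : ℕ) : ℤ) - 1 = ((m + 1 : ℕ) : ℤ) := by push_cast; ring
    rw [h1, coeff_logDivTwoPiI_natCast, coeff_logDivTwoPiI_natCast, if_neg (by omega),
      PowerSeries.coeff_log, PowerSeries.coeff_log, if_neg (by omega), if_neg (by omega)]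
    have h2 : (m : ℂ) + 2 ≠ 0 := by exact_mod_cast (by omega : m + 2 ≠ 0)
    have h3 : (m : ℂ) + 1 ≠ 0 := by exact_mod_cast (by omega : m + 1 ≠ 0)
    simp
    field_simp
    ring

/-- The substitution `x = log(1+y)/(2πi)` turns `d/dx` into `2πi (1+y) d/dy`; here applied to the
power `x^m`. -/
theorem coeff_logDivTwoPiI_zpow_pred (m k : ℤ) :
    (m : ℂ) * (logDivTwoPiI ^ (m - 1)).coeff k =
      kappa * (((k : ℂ) + 1) * (logDivTwoPiI ^ m).coeff (k + 1) +
        k * (logDivTwoPiI ^ m).coeff k) := by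
  have h1 : (1 + HahnSeries.single 1 1) * eulerOp (logDivTwoPiI ^ m) =
      m • (HahnSeries.single 1 kappa⁻¹ * logDivTwoPiI ^ (m - 1)) := by
    rw [eulerOp_zpow, ← one_add_X_mul_euler_log, mul_smul_comm]
    ring_nf
  have h2 := congrArg (fun f : LaurentSeries ℂ => f.coeff (k + 1)) h1
  simp only [add_mul, one_mul, HahnSeries.coeff_add, HahnSeries.coeff_single_mul,
    coeff_eulerOp, HahnSeries.coeff_smul, add_sub_cancel_right] at h2
  rw [zsmul_eq_mul] at h2
  push_cast at h2
  rw [h2]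
  field_simp [kappa_ne_zero]

/-- Residues of the differentials `x^m dx` in the coordinate `y`. -/
theorem coeff_zpow_mul_euler_log (m : ℤ) :
    (logDivTwoPiI ^ m * eulerOp logDivTwoPiI).coeff 0 = if m = -1 then 1 else 0 := by
  split_ifs with h
  · subst h
    rw [LaurentSeries.coeff_mul_lowest (a := -1) (b := 1)
      (fun j hj => coeff_logDivTwoPiI_zpow_of_lt hj)
      (fun j hj => by rw [coeff_eulerOp, coeff_logDivTwoPiI_of_lt hj, mul_zero]) (by norm_num)]
    have := congrArg (fun f : LaurentSeries ℂ => f.coeff 0)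
      (inv_mul_cancel₀ logDivTwoPiI_ne_zero)
    simp only [HahnSeries.coeff_one, if_true] at this
    rw [← zpow_neg_one, LaurentSeries.coeff_mul_lowest (a := -1) (b := 1)
      (fun j hj => coeff_logDivTwoPiI_zpow_of_lt hj)
      (fun j hj => coeff_logDivTwoPiI_of_lt hj) (by norm_num)] at this
    simpa using this
  · have h1 : (m + 1 : ℂ) ≠ 0 := by exact_mod_cast (by omega : m + 1 ≠ 0)
    have h2 := congrArg (fun f : LaurentSeries ℂ => f.coeff 0)
      (eulerOp_zpow logDivTwoPiI (m + 1))
    simp only [coeff_eulerOp, add_sub_cancel_right, 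
      HahnSeries.coeff_smul] at h2
    rw [zsmul_eq_mul] at h2
    simpa [h1] using h2.symm

/-! ### The kernel of the product and the coefficients of `(1+y)^T` -/

/-- For `f(x) = 2πi e^{2πix}/(e^{2πix} - 1)`, the coefficient of `yⁿ` in `f⁽ⁱ⁾(x)/i!` after the
substitution `x = log(1+y)/(2πi)`. As `f = 2πi (1 + y⁻¹)` and `d/dx = 2πi (1+y) d/dy` in the
coordinate `y`, these are given by a recursion. -/
def kernelCoeff : ℕ → ℤ → ℂ
  | 0, n => if n = 0 ∨ n = -1 then kappa else 0
  | i + 1, n => kappa * (((n : ℂ) + 1) * kernelCoeff i (n + 1) + n * kernelCoeff i n) / (i + 1)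

theorem kernelCoeff_of_pos (i : ℕ) {n : ℤ} (hn : 0 < n) : kernelCoeff i n = 0 := by
  induction i generalizing n with
  | zero => rw [kernelCoeff, if_neg (by omega)]
  | succ i ih => rw [kernelCoeff, ih hn, ih (by omega)]; simp

theorem kernelCoeff_succ_zero (i : ℕ) : kernelCoeff (i + 1) 0 = 0 := by
  rw [kernelCoeff, kernelCoeff_of_pos i (by norm_num)]; simp

/-- The `i`-th Hasse derivative of `∑ₚ cₚ xᵖ` truncated to `p < M`, in the coordinate `y`, where `cₚ`
is the constant term of `(log(1+y)/(2πi))^{-p-1}`. -/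
def kernelTrunc (M : ℤ) (i : ℕ) : LaurentSeries ℂ :=
  ∑ p ∈ Finset.Ico (-1) M,
    HahnSeries.C ((logDivTwoPiI ^ (-p - 1)).coeff 0 * ((Ring.choose p i : ℤ) : ℂ)) *
      logDivTwoPiI ^ (p - i)

theorem coeff_sum_C_mul {ι : Type*} (s : Finset ι) (c : ι → ℂ) (f : ι → LaurentSeries ℂ) (n : ℤ) :
    (∑ p ∈ s, HahnSeries.C (c p) * f p).coeff n = ∑ p ∈ s, c p * (f p).coeff n := by
  rw [HahnSeries.coeff_sum]
  refine Finset.sum_congr rfl fun p _ => ?_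
  rw [HahnSeries.C_mul_eq_smul, HahnSeries.coeff_smul, smul_eq_mul]

theorem coeff_kernelTrunc (M : ℤ) (i : ℕ) (n : ℤ) :
    (kernelTrunc M i).coeff n = ∑ p ∈ Finset.Ico (-1) M,
      (logDivTwoPiI ^ (-p - 1)).coeff 0 * ((Ring.choose p i : ℤ) : ℂ) *
        (logDivTwoPiI ^ (p - i)).coeff n :=
  coeff_sum_C_mul _ _ _ _

theorem coeff_kernelTrunc_of_lt (M : ℤ) (i : ℕ) {n : ℤ} (hn : n < -1 - i) :
    (kernelTrunc M i).coeff n = 0 := by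
  rw [coeff_kernelTrunc]
  refine Finset.sum_eq_zero fun p hp => ?_
  rw [Finset.mem_Ico] at hp
  rw [coeff_logDivTwoPiI_zpow_of_lt (n := p - i) (by omega), mul_zero]

theorem Ring.choose_succ_mul (p : ℤ) (i : ℕ) :
    ((i : ℤ) + 1) * Ring.choose p (i + 1) = (p - i) * Ring.choose p i := by
  have h2 := Ring.descPochhammer_eq_factorial_smul_choose p (i + 1)
  have h3 := Ring.descPochhammer_eq_factorial_smul_choose p i
  have h4 : (descPochhammer ℤ (i + 1)).smeval p = (descPochhammer ℤ i).smeval p * (p - i) := by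
    rw [descPochhammer_succ_right, Polynomial.smeval_mul, Polynomial.smeval_sub,
      Polynomial.smeval_X, Polynomial.smeval_natCast]
    simp
  rw [h2, h3, Nat.factorial_succ] at h4
  have h5 : (i.factorial : ℤ) ≠ 0 := by exact_mod_cast i.factorial_ne_zero
  apply mul_left_cancel₀ h5
  simp only [nsmul_eq_mul] at h4
  push_cast at h4
  linarith

theorem coeff_kernelTrunc_succ (M : ℤ) (i : ℕ) (n : ℤ) :
    (kernelTrunc M (i + 1)).coeff n =
      kappa * (((n : ℂ) + 1) * (kernelTrunc M i).coeff (n + 1) + n * (kernelTrunc M i).coeff n) /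
        (i + 1) := by
  have hi : (i : ℂ) + 1 ≠ 0 := by exact_mod_cast i.succ_ne_zero
  rw [eq_div_iff hi, coeff_kernelTrunc, coeff_kernelTrunc, coeff_kernelTrunc, Finset.mul_sum,
    Finset.mul_sum, ← Finset.sum_add_distrib, Finset.mul_sum, Finset.sum_mul]
  refine Finset.sum_congr rfl fun p _ => ?_
  have h1 := congrArg (Int.cast : ℤ → ℂ) (Ring.choose_succ_mul p i)
  have h2 := coeff_logDivTwoPiI_zpow_pred (p - i) n
  have h3 : p - i - 1 = p - ((i + 1 : ℕ) : ℤ) := by push_cast; ring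
  rw [h3] at h2
  push_cast at h1 h2 ⊢
  set c := (logDivTwoPiI ^ (-p - 1)).coeff 0
  set d := (logDivTwoPiI ^ (p - ((i : ℤ) + 1))).coeff n
  linear_combination c * d * h1 + c * ((Ring.choose p i : ℤ) : ℂ) * h2

/-- Up to terms of high degree, `∑ₚ cₚ xᵖ dx = y⁻¹ dy` for `x = log(1+y)/(2πi)`: the coefficient
`cₚ = Res_y x^{-p-1} y⁻¹` is the value on `y⁻¹ dy` of a functional dual to `xᵖ dx`, and a differential
killed by the functionals with `p < M` has no terms of low degree. -/
theorem coeff_kernelTrunc_zero_mul (M : ℤ) {n : ℤ} (hn : n ≤ M) :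
    (kernelTrunc M 0 * eulerOp logDivTwoPiI - 1).coeff n = 0 := by
  -- `H` is `y` times the difference of the two differentials
  set H := kernelTrunc M 0 * eulerOp logDivTwoPiI - 1 with hH
  have hψ : ∀ j < (1 : ℤ), (eulerOp logDivTwoPiI).coeff j = 0 := fun j hj => by
    rw [coeff_eulerOp, coeff_logDivTwoPiI_of_lt hj, mul_zero]
  have hneg : ∀ j < (0 : ℤ), H.coeff j = 0 := by
    intro j hj
    rw [hH, HahnSeries.coeff_sub, HahnSeries.coeff_one, if_neg (by omega), sub_zero]
    exact LaurentSeries.coeff_mul_eq_zero (a := -1) (b := 1)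
      (fun j hj => coeff_kernelTrunc_of_lt M 0 (by simpa using hj)) hψ (by omega)
  have hres : ∀ q ∈ Finset.Ico (-1) M, (H * logDivTwoPiI ^ (-q - 1)).coeff 0 = 0 := by
    intro q hq
    have : H * logDivTwoPiI ^ (-q - 1) = (∑ p ∈ Finset.Ico (-1) M,
        HahnSeries.C ((logDivTwoPiI ^ (-p - 1)).coeff 0) *
          (logDivTwoPiI ^ (p - q - 1) * eulerOp logDivTwoPiI)) - logDivTwoPiI ^ (-q - 1) := by
      rw [hH, kernelTrunc, sub_mul, one_mul, Finset.sum_mul, Finset.sum_mul]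
      congr 1
      refine Finset.sum_congr rfl fun p _ => ?_
      have : p - q - 1 = (p - ((0 : ℕ) : ℤ)) + (-q - 1) := by simp; ring
      rw [this, zpow_add₀ logDivTwoPiI_ne_zero, Ring.choose_zero_right]
      simp only [Int.cast_one, mul_one]
      ring
    rw [this, HahnSeries.coeff_sub, coeff_sum_C_mul]
    simp only [coeff_zpow_mul_euler_log]
    rw [Finset.sum_eq_single q]
    · rw [if_pos (by omega)]; ring
    · intro p _ hp
      rw [if_neg (by omega), mul_zero]
    · intro h; exact absurd hq h
  rcases lt_or_ge n 0 with h | h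
  · exact hneg n h
  · obtain ⟨m, rfl⟩ := Int.eq_ofNat_of_zero_le h
    clear h
    induction m using Nat.strong_induction_on with
    | _ m ih =>
      have hlow : ∀ j < (m : ℤ), H.coeff j = 0 := by
        intro j hj
        rcases lt_or_ge j 0 with h0 | h0
        · exact hneg j h0
        · obtain ⟨l, rfl⟩ := Int.eq_ofNat_of_zero_le h0
          exact ih l (by omega) (by omega)
      have h1 := hres (m - 1) (Finset.mem_Ico.2 (by omega))
      have h2 : -((m : ℤ) - 1) - 1 = -m := by ring
      rw [h2, LaurentSeries.coeff_mul_lowest hlow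
        (fun j hj => coeff_logDivTwoPiI_zpow_of_lt hj) (by ring)] at h1
      exact (mul_eq_zero.1 h1).resolve_right (coeff_logDivTwoPiI_zpow_self_ne_zero _)

theorem coeff_kernelTrunc_zero (M : ℤ) {n : ℤ} (hn : n < M) :
    (kernelTrunc M 0).coeff n = kernelCoeff 0 n := by
  set H := kernelTrunc M 0 * eulerOp logDivTwoPiI - 1 with hH
  have h1 : HahnSeries.single 1 kappa⁻¹ * kernelTrunc M 0 = (1 + HahnSeries.single 1 1) * (1 + H) := by
    rw [hH, ← one_add_X_mul_euler_log]; ring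
  have h2 := congrArg (fun f : LaurentSeries ℂ => f.coeff (n + 1)) h1
  simp only [add_mul, one_mul, HahnSeries.coeff_add, HahnSeries.coeff_single_mul,
    add_sub_cancel_right] at h2
  rw [coeff_kernelTrunc_zero_mul M (by omega : n + 1 ≤ M),
    coeff_kernelTrunc_zero_mul M (by omega : n ≤ M), HahnSeries.coeff_one,
    HahnSeries.coeff_one, inv_mul_eq_iff_eq_mul₀ kappa_ne_zero] at h2
  rw [h2, kernelCoeff]
  by_cases h0 : n = 0
  · subst h0; simp
  · by_cases h3 : n = -1
    · subst h3; simp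
    · rw [if_neg (by omega), if_neg (by omega), if_neg (by omega)]; simp

theorem coeff_kernelTrunc_eq (M : ℤ) (i : ℕ) {n : ℤ} (hn : n + i < M) :
    (kernelTrunc M i).coeff n = kernelCoeff i n := by
  induction i generalizing n with
  | zero => exact coeff_kernelTrunc_zero M (by simpa using hn)
  | succ i ih =>
    push_cast at hn
    rw [coeff_kernelTrunc_succ, kernelCoeff, ih (by omega), ih (by omega)]

/-- The Taylor coefficients of the kernel act on powers of `x` by the finitely many nonpositive
powers of `y` recorded in `kernelCoeff`. -/
theorem sum_kernel_mul (M : ℤ) (i : ℕ) (s k : ℤ) (h : k + s + 1 + i < M) :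
    ∑ p ∈ Finset.Ico (-1) M, (logDivTwoPiI ^ (-p - 1)).coeff 0 * ((Ring.choose p i : ℤ) : ℂ) *
        (logDivTwoPiI ^ (p - i - s - 1)).coeff k =
      ∑ n ∈ Finset.Icc (-1 - i : ℤ) 0, kernelCoeff i n * (logDivTwoPiI ^ (-s - 1)).coeff (k - n) := by
  have h1 : (kernelTrunc M i * logDivTwoPiI ^ (-s - 1)).coeff k = ∑ p ∈ Finset.Ico (-1) M,
      (logDivTwoPiI ^ (-p - 1)).coeff 0 * ((Ring.choose p i : ℤ) : ℂ) *
        (logDivTwoPiI ^ (p - i - s - 1)).coeff k := by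
    rw [kernelTrunc, Finset.sum_mul]
    simp only [mul_assoc (HahnSeries.C _)]
    rw [coeff_sum_C_mul]
    refine Finset.sum_congr rfl fun p _ => ?_
    rw [← zpow_add₀ logDivTwoPiI_ne_zero]
    congr 3
    ring
  rw [← h1, LaurentSeries.coeff_mul_eq_sum_Icc (a := -1 - i) (b := -s - 1)
    (fun j hj => coeff_kernelTrunc_of_lt M i hj) (fun j hj => coeff_logDivTwoPiI_zpow_of_lt hj)]
  have h2 : ∀ n ∈ Finset.Icc (-1 - i : ℤ) (k - (-s - 1)),
      (kernelTrunc M i).coeff n * (logDivTwoPiI ^ (-s - 1)).coeff (k - n) =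
        kernelCoeff i n * (logDivTwoPiI ^ (-s - 1)).coeff (k - n) := by
    intro n hn
    rw [Finset.mem_Icc] at hn
    rw [coeff_kernelTrunc_eq M i (by omega)]
  rw [Finset.sum_congr rfl h2]
  have hz : ∀ n, (0 < n ∨ k - (-s - 1) < n) →
      kernelCoeff i n * (logDivTwoPiI ^ (-s - 1)).coeff (k - n) = 0 := by
    rintro n (hn | hn)
    · rw [kernelCoeff_of_pos i hn, zero_mul]
    · rw [coeff_logDivTwoPiI_zpow_of_lt (by omega), mul_zero]
  rw [← Finset.sum_subset (s₁ := Finset.Icc (-1 - i : ℤ) (min 0 (k - (-s - 1)))),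
    ← Finset.sum_subset (s₁ := Finset.Icc (-1 - i : ℤ) (min 0 (k - (-s - 1))))
      (s₂ := Finset.Icc (-1 - i : ℤ) 0)]
  · exact Finset.Icc_subset_Icc_right (min_le_left _ _)
  · intro n hn hn'
    rw [Finset.mem_Icc] at hn hn'
    exact hz n (by omega)
  · exact Finset.Icc_subset_Icc_right (min_le_right _ _)
  · intro n hn hn'
    rw [Finset.mem_Icc] at hn hn'
    exact hz n (by omega)

/-- The power series `∑ⱼ s(j, i)/j! yʲ` of the coefficients of `Tⁱ` in `binom(T, j)`. -/
def stirlingSeries (i : ℕ) : PowerSeries ℂ :=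
  PowerSeries.mk fun j => ((j.factorial : ℂ)⁻¹) * (descPochhammer ℂ j).coeff i

theorem one_add_X_mul_deriv_log :
    (1 + PowerSeries.X) * PowerSeries.derivative ℂ (PowerSeries.log ℂ) = 1 := by
  rw [PowerSeries.deriv_log]
  ext n
  rw [add_mul, one_mul, map_add, PowerSeries.coeff_mk, PowerSeries.coeff_one]
  cases n with
  | zero => simp
  | succ n => rw [PowerSeries.coeff_succ_X_mul, PowerSeries.coeff_mk]; simp [pow_succ]

theorem stirlingSeries_zero : stirlingSeries 0 = 1 := by
  ext j
  rw [stirlingSeries, PowerSeries.coeff_mk, PowerSeries.coeff_one]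
  cases j with
  | zero => simp
  | succ j => rw [descPochhammer_succ_left]; simp

theorem one_add_X_mul_deriv_stirlingSeries (i : ℕ) :
    (1 + PowerSeries.X) * PowerSeries.derivative ℂ (stirlingSeries (i + 1)) = stirlingSeries i := by
  have hrec : ∀ j : ℕ, (descPochhammer ℂ (j + 1)).coeff (i + 1) =
      (descPochhammer ℂ j).coeff i - j * (descPochhammer ℂ j).coeff (i + 1) := by
    intro j
    rw [descPochhammer_succ_right, mul_sub, Polynomial.coeff_sub, Polynomial.coeff_mul_X,
      mul_comm _ (j : Polynomial ℂ), Polynomial.coeff_natCast_mul]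
  ext j
  rw [add_mul, one_mul, map_add, PowerSeries.coeff_derivative]
  have hfac : ∀ j : ℕ, (j.factorial : ℂ) ≠ 0 := fun j => by exact_mod_cast j.factorial_ne_zero
  cases j with
  | zero => simpa [stirlingSeries] using hrec 0
  | succ j =>
    rw [PowerSeries.coeff_succ_X_mul, PowerSeries.coeff_derivative]
    simp only [stirlingSeries, PowerSeries.coeff_mk]
    rw [hrec (j + 1), Nat.factorial_succ (j + 1)]
    have h1 := hfac (j + 1)
    have h2 : ((j : ℂ) + 1 + 1) ≠ 0 := by exact_mod_cast (by omega : j + 1 + 1 ≠ 0)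
    push_cast
    field_simp
    ring

/-- `∑ⱼ binom(T, j) yʲ = ∑ᵢ log(1+y)ⁱ Tⁱ / i!`, coefficientwise in `T`. -/
theorem stirlingSeries_eq (i : ℕ) :
    stirlingSeries i = PowerSeries.C ((i.factorial : ℂ)⁻¹) * PowerSeries.log ℂ ^ i := by
  induction i with
  | zero => simp [stirlingSeries_zero]
  | succ i ih =>
    apply PowerSeries.derivative.ext
    · have hne : (1 + PowerSeries.X : PowerSeries ℂ) ≠ 0 := by
        intro h
        have := congrArg PowerSeries.constantCoeff h
        simp at this
      apply mul_left_cancel₀ hne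
      rw [one_add_X_mul_deriv_stirlingSeries, ih, Derivation.leibniz, PowerSeries.derivative_C,
        PowerSeries.derivative_pow, smul_zero, add_zero, smul_eq_mul]
      have h0 : ((i : ℂ) + 1) ≠ 0 := by exact_mod_cast i.succ_ne_zero
      have h1 : ((i.factorial : ℂ)⁻¹) = (((i + 1).factorial : ℂ)⁻¹) * ((i + 1 : ℕ) : ℂ) := by
        rw [Nat.factorial_succ]
        push_cast
        field_simp
      rw [h1, map_mul, map_natCast]
      calc _ = PowerSeries.C (((i + 1).factorial : ℂ)⁻¹) * ((i + 1 : ℕ) : PowerSeries ℂ) *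
            PowerSeries.log ℂ ^ i *
            ((1 + PowerSeries.X) * PowerSeries.derivative ℂ (PowerSeries.log ℂ)) := by
            rw [one_add_X_mul_deriv_log, mul_one]
        _ = _ := by
            rw [Nat.add_sub_cancel]; ring
    · rw [← PowerSeries.coeff_zero_eq_constantCoeff_apply, stirlingSeries, PowerSeries.coeff_mk]
      simp [Polynomial.coeff_one]

/-! ### Finite sums, and modes of vertex operators -/

section FiniteSums

section

variable {V : Type*} [AddCommGroup V]

theorem finsum_eq_sum_range {f : ℕ → V} {M : ℕ} (hf : ∀ j, M ≤ j → f j = 0) :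
    ∑ᶠ j, f j = ∑ j ∈ Finset.range M, f j := by
  refine finsum_eq_sum_of_support_subset f fun j hj => ?_
  by_contra h
  exact hj (hf j (by simpa using h))

theorem sum_range_sum_range_eq_sum_antidiagonal {f : ℕ → ℕ → V} {M : ℕ}
    (hf : ∀ s a, M ≤ s + a → f s a = 0) :
    ∑ s ∈ Finset.range M, ∑ a ∈ Finset.range M, f s a =
      ∑ J ∈ Finset.range M, ∑ x ∈ Finset.HasAntidiagonal.antidiagonal J, f x.1 x.2 := by
  rw [← Finset.sum_product', Finset.sum_sigma']
  symm
  refine Finset.sum_of_injOn (fun x => x.2) ?_ ?_ ?_ ?_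
  · rintro ⟨J, x⟩ hx ⟨J', x'⟩ hx' h
    simp only [Finset.coe_sigma, Set.mem_sigma_iff, Finset.mem_coe, Finset.HasAntidiagonal.mem_antidiagonal] at hx hx' h
    obtain rfl := h
    obtain rfl : J = J' := hx.2.symm.trans hx'.2
    rfl
  · rintro ⟨J, x⟩ hx
    simp only [Finset.coe_sigma, Set.mem_sigma_iff, Finset.mem_coe, Finset.HasAntidiagonal.mem_antidiagonal,
      Finset.mem_range, Finset.mem_product] at hx ⊢
    omega
  · rintro ⟨s, a⟩ hx hx'
    refine hf s a ?_
    by_contra h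
    exact hx' ⟨⟨s + a, (s, a)⟩, by simpa using h, rfl⟩
  · intro x _
    rfl

end

variable {V : Type*} [AddCommGroup V] [Module ℂ V]

/-- The coefficients `(2πi)ʲ / j!` of `e^{2πi x}`. -/
def expKappa (j : ℕ) : ℂ := kappa ^ j / j.factorial

theorem expKappa_mul (s a : ℕ) :
    expKappa s * expKappa a = expKappa (s + a) * ((s + a).choose s : ℂ) := by
  have h : (s + a).choose s * s.factorial * a.factorial = (s + a).factorial := by
    rw [Nat.choose_symm_add, Nat.add_choose_mul_factorial_mul_factorial]
  have h' := congrArg (Nat.cast : ℕ → ℂ) h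
  have h1 : (s.factorial : ℂ) ≠ 0 := by exact_mod_cast s.factorial_ne_zero
  have h2 : (a.factorial : ℂ) ≠ 0 := by exact_mod_cast a.factorial_ne_zero
  have h3 : ((s + a).factorial : ℂ) ≠ 0 := by exact_mod_cast (s + a).factorial_ne_zero
  push_cast at h'
  rw [expKappa, expKappa, expKappa, div_mul_div_comm, div_mul_eq_mul_div,
    div_eq_div_iff (mul_ne_zero h1 h2) h3, pow_add, ← h']
  ring

theorem expKappa_succ (j : ℕ) : ((j : ℂ) + 1) * expKappa (j + 1) = kappa * expKappa j := by
  have h1 : (j.factorial : ℂ) ≠ 0 := by exact_mod_cast j.factorial_ne_zero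
  have h2 : ((j : ℂ) + 1) ≠ 0 := by exact_mod_cast j.succ_ne_zero
  rw [expKappa, expKappa, Nat.factorial_succ]
  push_cast
  field_simp
  rw [pow_succ']

/-- A form of Vandermonde's identity. It expresses that `e^{κx₁T} = e^{κx₀T} e^{κx₂T}` for
`x₁ = x₀ + x₂`, the reason why the factors `e^{κxT}` are compatible with the commutator formula. -/
theorem sum_vandermonde (p : ℤ) {M : ℕ} {Ψ : ℕ → ℕ → V}
    (h1 : ∀ J I, M ≤ J → Ψ J I = 0) (h2 : ∀ J I, M ≤ I → Ψ J I = 0) :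
    ∑ i ∈ Finset.range M, ∑ s ∈ Finset.range M, ∑ a ∈ Finset.range M,
        (((Ring.choose p i : ℤ) : ℂ) * (expKappa s * expKappa a)) • Ψ (s + a) (i + s) =
      ∑ J ∈ Finset.range M, ∑ I ∈ Finset.range M,
        (expKappa J * ((Ring.choose (p + J) I : ℤ) : ℂ)) • Ψ J I := by
  have step1 : ∀ i, ∑ s ∈ Finset.range M, ∑ a ∈ Finset.range M,
        (((Ring.choose p i : ℤ) : ℂ) * (expKappa s * expKappa a)) • Ψ (s + a) (i + s) =
      ∑ J ∈ Finset.range M, ∑ s ∈ Finset.range M,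
        (((Ring.choose p i : ℤ) : ℂ) * (expKappa J * (J.choose s : ℂ))) • Ψ J (i + s) := by
    intro i
    rw [sum_range_sum_range_eq_sum_antidiagonal
      (fun s a h => by rw [h1 _ _ h, smul_zero])]
    refine Finset.sum_congr rfl fun J hJ => ?_
    have : ∀ x ∈ Finset.HasAntidiagonal.antidiagonal J,
        (((Ring.choose p i : ℤ) : ℂ) * (expKappa x.1 * expKappa x.2)) • Ψ (x.1 + x.2) (i + x.1) =
        (fun s _ => (((Ring.choose p i : ℤ) : ℂ) *
          (expKappa J * (J.choose s : ℂ))) • Ψ J (i + s)) x.1 x.2 := by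
      intro x hx
      rw [Finset.HasAntidiagonal.mem_antidiagonal] at hx
      simp only [expKappa_mul, hx]
    rw [Finset.sum_congr rfl this, Finset.Nat.sum_antidiagonal_eq_sum_range_succ
      (fun s _ => (((Ring.choose p i : ℤ) : ℂ) * (expKappa J * (J.choose s : ℂ))) • Ψ J (i + s))]
    rw [Finset.mem_range] at hJ
    refine Finset.sum_subset (Finset.range_subset_range.2 (by omega)) fun s _ hs => ?_
    rw [Finset.mem_range] at hs
    rw [Nat.choose_eq_zero_of_lt (by omega)]
    simp
  rw [Finset.sum_congr rfl fun i _ => step1 i, Finset.sum_comm]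
  refine Finset.sum_congr rfl fun J _ => ?_
  rw [sum_range_sum_range_eq_sum_antidiagonal (fun i s h => by rw [h2 _ _ h, smul_zero])]
  refine Finset.sum_congr rfl fun I _ => ?_
  rw [Ring.add_choose_eq I (Commute.all p J)]
  push_cast
  rw [Finset.mul_sum, Finset.sum_smul]
  refine Finset.sum_congr rfl fun x hx => ?_
  rw [Finset.HasAntidiagonal.mem_antidiagonal] at hx
  rw [hx, Ring.choose_natCast]
  push_cast
  congr 1
  ring

/-- A locally finite sum of bilinear maps. -/
def finsumBilin {ι : Type*} (B : ι → V →ₗ[ℂ] V →ₗ[ℂ] V)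
    (hB : ∀ u w, (Function.support fun i => B i u w).Finite) : V →ₗ[ℂ] V →ₗ[ℂ] V :=
  LinearMap.mk₂ ℂ (fun u w => ∑ᶠ i, B i u w)
    (fun u u' w => by
      simp only [map_add, LinearMap.add_apply]
      exact finsum_add_distrib (hB u w) (hB u' w))
    (fun c u w => by
      simp only [map_smul, LinearMap.smul_apply]
      exact (smul_finsum c _).symm)
    (fun u w w' => by
      simp only [map_add]
      exact finsum_add_distrib (hB u w) (hB u w'))
    (fun c u w => by
      simp only [map_smul]
      exact (smul_finsum c _).symm)

/-- Every vector lies in a finitely generated `T`-stable subspace. -/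
def LocallyFiniteOp (T : Module.End ℂ V) : Prop :=
  ∀ u, ∃ S : Submodule ℂ V, S.FG ∧ u ∈ S ∧ ∀ x ∈ S, T x ∈ S

theorem pow_apply_mem_of_stable {T : Module.End ℂ V} {S : Submodule ℂ V}
    (hS : ∀ x ∈ S, T x ∈ S) (j : ℕ) {x : V} (hx : x ∈ S) : (T ^ j) x ∈ S := by
  induction j with
  | zero => simpa using hx
  | succ j ih => rw [pow_succ', Module.End.mul_apply]; exact hS _ ih

end FiniteSums

namespace VertexOperatorAlgebra

variable {V : Type*} [AddCommGroup V] [Module ℂ V] (A : VertexOperatorAlgebra V)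

/-- The `n`-th mode `(u, v) ↦ uₙ v` as a bilinear map. -/
def mode (n : ℤ) : V →ₗ[ℂ] V →ₗ[ℂ] V :=
  (LinearMap.proj n ∘ₗ VertexOperator.ncoeff) ∘ₗ A.Y

theorem vertexMode_eq_mode (n : ℤ) (u v : V) : vertexMode A.Y u n v = A.mode n u v := rfl

theorem exists_mode_eq_zero (u w : V) : ∃ N : ℕ, ∀ n : ℤ, N ≤ n → A.mode n u w = 0 := by
  refine ⟨(-((HahnModule.of ℂ).symm (A.Y u w)).order).toNat, fun n hn => ?_⟩
  exact VertexOperator.ncoeff_eq_zero_of_lt_order (A.Y u) n w (by omega)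

/-- Lower truncation is uniform on finite-dimensional subspaces. -/
theorem exists_mode_eq_zero_of_fg {S S' : Submodule ℂ V} (hS : S.FG) (hS' : S'.FG) :
    ∃ N : ℕ, ∀ u ∈ S, ∀ w ∈ S', ∀ n : ℤ, N ≤ n → A.mode n u w = 0 := by
  classical
  obtain ⟨s, rfl⟩ := hS
  obtain ⟨s', rfl⟩ := hS'
  choose N hN using A.exists_mode_eq_zero
  refine ⟨s.sup fun u => s'.sup fun w => N u w, fun u hu w hw n hn => ?_⟩
  induction hu using Submodule.span_induction with
  | mem u hu =>
    induction hw using Submodule.span_induction with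
    | mem w hw =>
      refine hN u w n (le_trans ?_ hn)
      exact_mod_cast le_trans (Finset.le_sup (f := fun w => N u w) hw)
        (Finset.le_sup (f := fun u => s'.sup fun w => N u w) hu)
    | zero => simp
    | add x y _ _ hx hy => rw [map_add, hx, hy, add_zero]
    | smul c x _ hx => rw [map_smul, hx, smul_zero]
  | zero => simp
  | add x y _ _ hx hy => rw [map_add, LinearMap.add_apply, hx, hy, add_zero]
  | smul c x _ hx => rw [map_smul, LinearMap.smul_apply, hx, smul_zero]

/-- The commutator formula for the modes of two vertex operators. -/
theorem mode_commutator (u v w : V) (p q : ℤ) :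
    A.mode p u (A.mode q v w) - A.mode q v (A.mode p u w) =
      ∑ᶠ i : ℕ, ((Ring.choose p i : ℤ) : ℂ) • A.mode (p + q - i) (A.mode i u v) w := by
  have h := A.jacobi u v w 0 p q
  simp only [vertexMode_eq_mode, zero_add, add_zero] at h
  rw [h, finsum_eq_single _ 0, finsum_eq_single _ 0]
  · simp
  · intro i hi
    rw [Ring.choose_zero_pos ℤ (Nat.pos_of_ne_zero hi)]
    simp
  · intro i hi
    rw [Ring.choose_zero_pos ℤ (Nat.pos_of_ne_zero hi)]
    simp

/-- The Leibniz rule for the powers of an operator `T` that acts as a derivation on the products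
`uₙ v` with `u ∈ V₀`. -/
theorem pow_apply_mode {T : Module.End ℂ V} {V₀ : Submodule ℂ V} (hV₀ : ∀ u ∈ V₀, T u ∈ V₀)
    (hT : ∀ u ∈ V₀, ∀ (v : V) (n : ℤ),
      T (A.mode n u v) = A.mode n (T u) v + A.mode n u (T v))
    {u : V} (hu : u ∈ V₀) (v : V) (n : ℤ) (m : ℕ) :
    (T ^ m) (A.mode n u v) = ∑ x ∈ Finset.HasAntidiagonal.antidiagonal m,
      m.choose x.1 • A.mode n ((T ^ x.1) u) ((T ^ x.2) v) := by
  induction m with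
  | zero => simp
  | succ m ih =>
    rw [pow_succ', Module.End.mul_apply, ih, map_sum,
      Finset.sum_antidiagonal_choose_succ_nsmul
        (fun a l => A.mode n ((T ^ a) u) ((T ^ l) v)), ← Finset.sum_add_distrib]
    refine Finset.sum_congr rfl fun x hx => ?_
    rw [map_nsmul, hT _ (pow_apply_mem_of_stable hV₀ _ hu), pow_succ' T x.1,
      pow_succ' T x.2, Module.End.mul_apply, Module.End.mul_apply, smul_add, add_comm]
    congr 2
    rw [Finset.HasAntidiagonal.mem_antidiagonal] at hx
    rw [← Nat.choose_symm_of_eq_add hx.symm]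

end VertexOperatorAlgebra

/-! ### Twisted modes and their commutator formula -/

namespace VertexOperatorAlgebra

variable {V : Type*} [AddCommGroup V] [Module ℂ V] (A : VertexOperatorAlgebra V)
  {T : Module.End ℂ V}

theorem exists_mode_pow_eq_zero (hT : LocallyFiniteOp T) (u w : V) :
    ∃ N : ℕ, ∀ (j : ℕ) (n : ℤ), N ≤ n → A.mode n ((T ^ j) u) w = 0 := by
  obtain ⟨S, hS, huS, hTS⟩ := hT u
  obtain ⟨N, hN⟩ := A.exists_mode_eq_zero_of_fg hS (Submodule.fg_span_singleton w)
  exact ⟨N, fun j n hn => hN _ (pow_apply_mem_of_stable hTS j huS) _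
    (Submodule.mem_span_singleton_self w) n hn⟩

theorem finite_support_mode_pow (hT : LocallyFiniteOp T) (p : ℤ) (u w : V) :
    (Function.support fun j : ℕ =>
      (expKappa j • (A.mode (p + j) ∘ₗ (T ^ j)) : V →ₗ[ℂ] V →ₗ[ℂ] V) u w).Finite := by
  obtain ⟨N, hN⟩ := A.exists_mode_pow_eq_zero hT u w
  refine (Set.finite_lt_nat (N - p).toNat).subset fun j hj => ?_
  by_contra h
  refine hj ?_
  simp only [Set.mem_ofPred_eq, not_lt] at h
  simp only [LinearMap.smul_apply, LinearMap.comp_apply]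
  rw [hN j _ (by omega), smul_zero]

/-- The `p`-th mode of the twisted vertex operator `Y(e^{2πixT} u, x) = ∑ₚ twMode p u x^{-p-1}`. -/
def twMode (hT : LocallyFiniteOp T) (p : ℤ) : V →ₗ[ℂ] V →ₗ[ℂ] V :=
  finsumBilin (fun j : ℕ => expKappa j • (A.mode (p + j) ∘ₗ (T ^ j)))
    (A.finite_support_mode_pow hT p)

variable (hT : LocallyFiniteOp T)

theorem twMode_apply (p : ℤ) (u w : V) :
    A.twMode hT p u w = ∑ᶠ j : ℕ, expKappa j • A.mode (p + j) ((T ^ j) u) w := rfl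

theorem twMode_eq_sum {p : ℤ} {u w : V} {M : ℕ}
    (h : ∀ j : ℕ, M ≤ j → A.mode (p + j) ((T ^ j) u) w = 0) :
    A.twMode hT p u w =
      ∑ j ∈ Finset.range M, expKappa j • A.mode (p + j) ((T ^ j) u) w := by
  rw [twMode_apply, finsum_eq_sum_range]
  intro j hj
  rw [h j hj, smul_zero]

theorem exists_twMode_eq_zero (u w : V) : ∃ N : ℕ, ∀ p : ℤ, N ≤ p → A.twMode hT p u w = 0 := by
  obtain ⟨N, hN⟩ := A.exists_mode_pow_eq_zero hT u w
  refine ⟨N, fun p hp => ?_⟩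
  rw [A.twMode_eq_sum hT (M := 0) fun j _ => hN j _ (by omega), Finset.sum_range_zero]

/-- If `T` acts by derivations on products with first factor in `V₀`, the twisted modes satisfy
the same commutator formula as the untwisted ones. -/
theorem twMode_commutator {V₀ : Submodule ℂ V} (hV₀ : ∀ u ∈ V₀, T u ∈ V₀)
    (hD : ∀ u ∈ V₀, ∀ (v : V) (n : ℤ),
      T (A.mode n u v) = A.mode n (T u) v + A.mode n u (T v))
    {u : V} (hu : u ∈ V₀) (v w : V) (p q : ℤ) :
    A.twMode hT p u (A.twMode hT q v w) - A.twMode hT q v (A.twMode hT p u w) =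
      ∑ᶠ i : ℕ, ((Ring.choose p i : ℤ) : ℂ) •
        A.twMode hT (p + q - i) (A.twMode hT i u v) w := by
  obtain ⟨S, hS, huS, hTS⟩ := hT u
  obtain ⟨S', hS', hvS, hTS'⟩ := hT v
  have huS' : ∀ j, (T ^ j) u ∈ S := fun j => pow_apply_mem_of_stable hTS j huS
  have hvS' : ∀ j, (T ^ j) v ∈ S' := fun j => pow_apply_mem_of_stable hTS' j hvS
  -- a common bound for all the sums involved
  obtain ⟨M₁, hM₁⟩ := A.exists_mode_eq_zero_of_fg hS hS'
  have hS₃ : (⨆ i : Fin M₁, Submodule.map₂ (A.mode (i : ℕ)) S S').FG :=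
    Submodule.fg_iSup _ fun i => hS.map₂ _ hS'
  obtain ⟨M₂, hM₂⟩ := A.exists_mode_eq_zero_of_fg hS₃ (Submodule.fg_span_singleton w)
  have hM₂' : ∀ x ∈ S, ∀ y ∈ S', ∀ (I : ℕ) (n : ℤ), M₂ ≤ n → A.mode n (A.mode I x y) w = 0 := by
    intro x hx y hy I n hn
    by_cases hI : I < M₁
    · exact hM₂ _ (Submodule.mem_iSup_of_mem (⟨I, hI⟩ : Fin M₁)
        (Submodule.apply_mem_map₂ _ hx hy)) _ (Submodule.mem_span_singleton_self w) n hn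
    · rw [hM₁ x hx y hy I (by omega)]; simp
  obtain ⟨N₁, hN₁⟩ := A.exists_mode_pow_eq_zero hT u (A.twMode hT q v w)
  obtain ⟨N₂, hN₂⟩ := A.exists_mode_pow_eq_zero hT u w
  obtain ⟨N₃, hN₃⟩ := A.exists_mode_pow_eq_zero hT v w
  obtain ⟨N₄, hN₄⟩ := A.exists_mode_pow_eq_zero hT v (A.twMode hT p u w)
  obtain ⟨M, hM⟩ : ∃ M : ℕ, M = M₁ + M₂ + N₁ + N₂ + N₃ + N₄ + p.natAbs + q.natAbs := ⟨_, rfl⟩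
  set Ψ : ℕ → ℕ → ℕ → V := fun l J I =>
    A.mode (p + q + J + l - I) (A.mode I ((T ^ J) u) ((T ^ l) v)) w with hΨ
  have hΨI : ∀ l J I, M ≤ I → Ψ l J I = 0 := by
    intro l J I hI
    simp only [hΨ]
    rw [hM₁ _ (huS' J) _ (hvS' l) I (by omega)]; simp
  have hΨJ : ∀ l J I, M ≤ J + l → Ψ l J I = 0 := by
    intro l J I hJ
    by_cases hI : I < M₁
    · exact hM₂' _ (huS' J) _ (hvS' l) I _ (by omega)
    · simp only [hΨ]
      rw [hM₁ _ (huS' J) _ (hvS' l) I (by omega)]; simp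
  have e1 : A.twMode hT p u (A.twMode hT q v w) = ∑ J ∈ Finset.range M, ∑ l ∈ Finset.range M,
      (expKappa J * expKappa l) •
        A.mode (p + J) ((T ^ J) u) (A.mode (q + l) ((T ^ l) v) w) := by
    rw [A.twMode_eq_sum hT (M := M) fun j hj => hN₁ j _ (by omega)]
    refine Finset.sum_congr rfl fun J _ => ?_
    rw [A.twMode_eq_sum hT (M := M) fun j hj => hN₃ j _ (by omega), map_sum, Finset.smul_sum]
    refine Finset.sum_congr rfl fun l _ => ?_
    rw [map_smul, smul_smul]
  have e2 : A.twMode hT q v (A.twMode hT p u w) = ∑ J ∈ Finset.range M, ∑ l ∈ Finset.range M,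
      (expKappa J * expKappa l) •
        A.mode (q + l) ((T ^ l) v) (A.mode (p + J) ((T ^ J) u) w) := by
    rw [A.twMode_eq_sum hT (M := M) fun j hj => hN₄ j _ (by omega), Finset.sum_comm]
    refine Finset.sum_congr rfl fun l _ => ?_
    rw [A.twMode_eq_sum hT (M := M) fun j hj => hN₂ j _ (by omega), map_sum, Finset.smul_sum]
    refine Finset.sum_congr rfl fun J _ => ?_
    rw [map_smul, smul_smul, mul_comm]
  have e3 : ∀ J l : ℕ, A.mode (p + J) ((T ^ J) u) (A.mode (q + l) ((T ^ l) v) w) -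
      A.mode (q + l) ((T ^ l) v) (A.mode (p + J) ((T ^ J) u) w) =
      ∑ I ∈ Finset.range M, ((Ring.choose (p + J) I : ℤ) : ℂ) • Ψ l J I := by
    intro J l
    rw [A.mode_commutator, finsum_eq_sum_range (M := M)]
    · refine Finset.sum_congr rfl fun I _ => ?_
      simp only [hΨ]
      rw [show p + J + (q + l) - I = p + q + J + l - I by ring]
    · intro I hI
      rw [hM₁ _ (huS' J) _ (hvS' l) I (by omega)]; simp
  have e4 : ∀ i s : ℕ, A.twMode hT (p + q - i) (A.mode (i + s : ℕ) ((T ^ s) u) v) w =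
      ∑ l ∈ Finset.range M, ∑ a ∈ Finset.range M,
        (expKappa a * expKappa l) • Ψ l (s + a) (i + s) := by
    intro i s
    have hpow : ∀ m : ℕ, (T ^ m) (A.mode (i + s : ℕ) ((T ^ s) u) v) =
        ∑ x ∈ Finset.HasAntidiagonal.antidiagonal m,
          m.choose x.1 • A.mode (i + s : ℕ) ((T ^ (s + x.1)) u) ((T ^ x.2) v) := by
      intro m
      rw [A.pow_apply_mode hV₀ hD (pow_apply_mem_of_stable hV₀ s hu)]
      refine Finset.sum_congr rfl fun x _ => ?_
      rw [add_comm s, pow_add, Module.End.mul_apply]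
    rw [A.twMode_eq_sum hT (M := M), Finset.sum_comm,
      sum_range_sum_range_eq_sum_antidiagonal
        (fun a l h => by rw [hΨJ _ _ _ (by omega), smul_zero])]
    · refine Finset.sum_congr rfl fun m _ => ?_
      rw [hpow, map_sum, LinearMap.sum_apply, Finset.smul_sum]
      refine Finset.sum_congr rfl fun x hx => ?_
      rw [Finset.HasAntidiagonal.mem_antidiagonal] at hx
      rw [expKappa_mul, hx, map_nsmul, LinearMap.smul_apply, ← Nat.cast_smul_eq_nsmul ℂ, smul_smul]
      simp only [hΨ]
      rw [show p + q + ((s + x.1 : ℕ) : ℤ) + (x.2 : ℤ) - ((i + s : ℕ) : ℤ) = p + q - i + m by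
        rw [← hx]; push_cast; ring]
    · intro m hm
      rw [hpow, map_sum, LinearMap.sum_apply]
      refine Finset.sum_eq_zero fun x _ => ?_
      rw [map_nsmul, LinearMap.smul_apply]
      by_cases hI : i + s < M₁
      · rw [hM₂' _ (huS' _) _ (hvS' _) _ _ (by omega), smul_zero]
      · rw [hM₁ _ (huS' _) _ (hvS' _) _ (by omega)]; simp
  have e5 : ∀ i : ℕ, A.twMode hT (p + q - i) (A.twMode hT i u v) w =
      ∑ s ∈ Finset.range M, ∑ l ∈ Finset.range M, ∑ a ∈ Finset.range M,
        (expKappa s * (expKappa a * expKappa l)) • Ψ l (s + a) (i + s) := by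
    intro i
    rw [A.twMode_eq_sum hT (p := i) (M := M) (fun j hj => by
      rw [hM₁ _ (huS' j) _ hvS _ (by omega)]), map_sum, LinearMap.sum_apply]
    refine Finset.sum_congr rfl fun s _ => ?_
    have : ((i : ℤ) + (s : ℤ)) = ((i + s : ℕ) : ℤ) := by push_cast; ring
    rw [map_smul, LinearMap.smul_apply, this, e4, Finset.smul_sum]
    refine Finset.sum_congr rfl fun l _ => ?_
    rw [Finset.smul_sum]
    refine Finset.sum_congr rfl fun a _ => ?_
    rw [smul_smul]
  rw [finsum_eq_sum_range (M := M), e1, e2, ← Finset.sum_sub_distrib]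
  · have hL : ∀ l : ℕ, ∑ J ∈ Finset.range M, ∑ I ∈ Finset.range M,
        (expKappa J * ((Ring.choose (p + J) I : ℤ) : ℂ)) • Ψ l J I =
        ∑ i ∈ Finset.range M, ∑ s ∈ Finset.range M, ∑ a ∈ Finset.range M,
        (((Ring.choose p i : ℤ) : ℂ) * (expKappa s * expKappa a)) • Ψ l (s + a) (i + s) :=
      fun l => (sum_vandermonde p (fun J I h => hΨJ l J I (by omega)) (hΨI l)).symm
    calc _ = ∑ l ∈ Finset.range M, expKappa l • ∑ J ∈ Finset.range M, ∑ I ∈ Finset.range M,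
          (expKappa J * ((Ring.choose (p + J) I : ℤ) : ℂ)) • Ψ l J I := by
          simp only [← Finset.sum_sub_distrib, ← smul_sub, e3]
          rw [Finset.sum_comm]
          refine Finset.sum_congr rfl fun l _ => ?_
          rw [Finset.smul_sum]
          refine Finset.sum_congr rfl fun J _ => ?_
          rw [Finset.smul_sum, Finset.smul_sum]
          refine Finset.sum_congr rfl fun I _ => ?_
          rw [smul_smul, smul_smul]
          congr 1
          ring
      _ = _ := by
          simp only [hL, e5, Finset.smul_sum, smul_smul]
          rw [Finset.sum_comm]
          refine Finset.sum_congr rfl fun i _ => ?_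
          rw [Finset.sum_comm]
          refine Finset.sum_congr rfl fun s _ => ?_
          refine Finset.sum_congr rfl fun l _ => ?_
          refine Finset.sum_congr rfl fun a _ => ?_
          congr 1
          ring
  · intro i hi
    rw [A.twMode_eq_sum hT (p := i) (M := 0) (fun j hj => by
      rw [hM₁ _ (huS' j) _ hvS _ (by omega)])]
    simp

/-- The derivative `d/dx Y(e^{2πixT} u, x) = Y(e^{2πixT} (L(-1) + 2πiT) u, x)` in modes. -/
theorem twMode_derivative (hL : ∀ u, T (A.mode 0 A.conformal u) = A.mode 0 A.conformal (T u))
    (p : ℤ) (u w : V) :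
    A.twMode hT p (A.mode 0 A.conformal u + kappa • T u) w =
      (-(p : ℂ)) • A.twMode hT (p - 1) u w := by
  have hLpow : ∀ j : ℕ, (T ^ j) (A.mode 0 A.conformal u) = A.mode 0 A.conformal ((T ^ j) u) := by
    intro j
    induction j with
    | zero => simp
    | succ j ih => rw [pow_succ', Module.End.mul_apply, ih, hL, Module.End.mul_apply]
  obtain ⟨N, hN⟩ := A.exists_mode_pow_eq_zero hT u w
  obtain ⟨N', hN'⟩ := A.exists_mode_pow_eq_zero hT (A.mode 0 A.conformal u) w
  obtain ⟨N'', hN''⟩ := A.exists_mode_pow_eq_zero hT (T u) w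
  obtain ⟨M, hM⟩ : ∃ M : ℕ, M = N + N' + N'' + p.natAbs + 1 := ⟨_, rfl⟩
  rw [map_add, LinearMap.add_apply, map_smul, LinearMap.smul_apply,
    A.twMode_eq_sum hT (M := M + 1) fun j hj => hN' j _ (by omega),
    A.twMode_eq_sum hT (M := M) fun j hj => hN'' j _ (by omega),
    A.twMode_eq_sum hT (M := M + 1) fun j hj => hN j _ (by omega)]
  have e1 : ∀ j : ℕ, expKappa j • A.mode (p + j) ((T ^ j) (A.mode 0 A.conformal u)) w =
      (-((p : ℂ) + j) * expKappa j) • A.mode (p - 1 + j) ((T ^ j) u) w := by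
    intro j
    have := A.derivative ((T ^ j) u) w (p + j)
    simp only [vertexMode_eq_mode] at this
    rw [hLpow, this, smul_smul]
    push_cast
    rw [show p + (j : ℤ) - 1 = p - 1 + j by ring]
    congr 1
    ring
  have e2 : kappa • ∑ j ∈ Finset.range M, expKappa j • A.mode (p + j) ((T ^ j) (T u)) w =
      ∑ j ∈ Finset.range (M + 1), ((j : ℂ) * expKappa j) • A.mode (p - 1 + j) ((T ^ j) u) w := by
    rw [Finset.sum_range_succ', Finset.smul_sum]
    simp only [Nat.cast_zero, zero_mul, zero_smul, add_zero]
    refine Finset.sum_congr rfl fun j _ => ?_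
    push_cast
    rw [expKappa_succ, smul_smul, pow_succ, Module.End.mul_apply]
    rw [show p - 1 + ((j : ℤ) + 1) = p + j by ring]
  rw [e2, Finset.sum_congr rfl fun j _ => e1 j, ← Finset.sum_add_distrib, Finset.smul_sum]
  refine Finset.sum_congr rfl fun j _ => ?_
  rw [← add_smul, smul_smul]
  congr 1
  ring

end VertexOperatorAlgebra

/-! ### Coefficients in the coordinate `y` -/

theorem sum_Ico_eq_finsum {V : Type*} [AddCommMonoid V] {f : ℤ → V} {a b : ℤ}
    (ha : ∀ p < a, f p = 0) (hb : ∀ p, b ≤ p → f p = 0) :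
    ∑ᶠ p, f p = ∑ p ∈ Finset.Ico a b, f p := by
  refine finsum_eq_sum_of_support_subset f fun p hp => ?_
  by_contra h
  rw [Finset.coe_Ico, Set.mem_Ico, not_and_or, not_le, not_lt] at h
  exact hp (h.elim (ha p) (hb p))

theorem finsum_add_right {V : Type*} [AddCommMonoid V] (f : ℤ → V) (i : ℤ) :
    ∑ᶠ p, f (p + i) = ∑ᶠ p, f p :=
  finsum_comp_equiv (Equiv.addRight i)

/-- `∑ⱼ binom(T, j) yʲ = ∑ᵢ (2πi φ(y))ⁱ Tⁱ / i!` for `φ(y) = log(1+y)/(2πi)`, multiplied by a power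
of `φ`. -/
theorem sum_coeff_mul_stirlingSeries (m k : ℤ) (i : ℕ) {J : ℕ} (hJ : k < m + J) :
    ∑ j ∈ Finset.range J, (logDivTwoPiI ^ m).coeff (k - j) * PowerSeries.coeff j (stirlingSeries i) =
      expKappa i * (logDivTwoPiI ^ (m + i)).coeff k := by
  have hφ : HahnSeries.ofPowerSeries ℤ ℂ (PowerSeries.log ℂ) =
      HahnSeries.C kappa * logDivTwoPiI := by
    rw [HahnSeries.C_mul_eq_smul, logDivTwoPiI, smul_smul]
    change _ = (kappa * kappa⁻¹) • _
    rw [mul_inv_cancel₀ kappa_ne_zero, one_smul]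
  have hS : HahnSeries.ofPowerSeries ℤ ℂ (stirlingSeries i) =
      HahnSeries.C (expKappa i) * logDivTwoPiI ^ (i : ℤ) := by
    rw [stirlingSeries_eq, map_mul, map_pow, hφ, HahnSeries.ofPowerSeries_C, mul_pow, ← mul_assoc,
      ← map_pow, ← map_mul, zpow_natCast, expKappa, div_eq_mul_inv, mul_comm (kappa ^ i)]
  have h1 : (HahnSeries.ofPowerSeries ℤ ℂ (stirlingSeries i) * logDivTwoPiI ^ m).coeff k =
      expKappa i * (logDivTwoPiI ^ (m + i)).coeff k := by
    rw [hS, mul_assoc, ← zpow_add₀ logDivTwoPiI_ne_zero, HahnSeries.C_mul_eq_smul,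
      HahnSeries.coeff_smul, smul_eq_mul, add_comm]
  have hneg : ∀ j < (0 : ℤ), (HahnSeries.ofPowerSeries ℤ ℂ (stirlingSeries i)).coeff j = 0 :=
    fun j hj => by rw [PowerSeries.coeff_coe, if_pos hj]
  rw [← h1, LaurentSeries.coeff_mul_eq_sum_Icc hneg
    (fun j hj => coeff_logDivTwoPiI_zpow_of_lt hj)]
  symm
  refine Finset.sum_of_injOn Int.toNat ?_ ?_ ?_ ?_
  · intro x hx y hy h
    rw [Finset.coe_Icc, Set.mem_Icc] at hx hy
    omega
  · intro x hx
    rw [Finset.coe_Icc, Set.mem_Icc] at hx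
    rw [Finset.coe_range, Set.mem_Iio]
    omega
  · intro j _ hj
    rw [coeff_logDivTwoPiI_zpow_of_lt, zero_mul]
    by_contra h
    refine hj ⟨(j : ℤ), ?_, by simp⟩
    rw [Finset.coe_Icc, Set.mem_Icc]
    omega
  · intro x hx
    rw [Finset.mem_Icc] at hx
    rw [PowerSeries.coeff_coe, if_neg (by omega), mul_comm, Int.toNat_of_nonneg hx.1,
      show x.natAbs = x.toNat by omega]

theorem onePlusPow_eq_sum {V : Type*} [AddCommGroup V] [Module ℂ V] (T : Module.End ℂ V) (u : V)
    {j J : ℕ} (h : j < J) :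
    onePlusPow T u j =
      ∑ i ∈ Finset.range J, PowerSeries.coeff j (stirlingSeries i) • (T ^ i) u := by
  rw [onePlusPow, Polynomial.aeval_eq_sum_range' (n := J)
    (by rw [descPochhammer_natDegree]; exact h), LinearMap.sum_apply, Finset.smul_sum]
  refine Finset.sum_congr rfl fun i _ => ?_
  rw [LinearMap.smul_apply, smul_smul, stirlingSeries, PowerSeries.coeff_mk]

namespace VertexOperatorAlgebra

variable {V : Type*} [AddCommGroup V] [Module ℂ V] (A : VertexOperatorAlgebra V)
  {T : Module.End ℂ V} (hT : LocallyFiniteOp T)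

theorem finite_support_twMode (k : ℤ) (u w : V) :
    (Function.support fun p : ℤ =>
      ((logDivTwoPiI ^ (-p - 1)).coeff k • A.twMode hT p : V →ₗ[ℂ] V →ₗ[ℂ] V) u w).Finite := by
  obtain ⟨N, hN⟩ := A.exists_twMode_eq_zero hT u w
  refine (Set.finite_Ico (-1 - k) N).subset fun p hp => ?_
  by_contra h
  rw [Set.mem_Ico, not_and_or, not_le, not_lt] at h
  refine hp ?_
  simp only [LinearMap.smul_apply]
  rcases h with h | h
  · rw [coeff_logDivTwoPiI_zpow_of_lt (by omega), zero_smul]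
  · rw [hN p h, smul_zero]

/-- The coefficient of `yᵏ` in `Y((1+y)^T u, log(1+y)/(2πi)) w`, as a bilinear map in `u` and `w`. -/
def twCoeff (k : ℤ) : V →ₗ[ℂ] V →ₗ[ℂ] V :=
  finsumBilin (fun p : ℤ => (logDivTwoPiI ^ (-p - 1)).coeff k • A.twMode hT p)
    (A.finite_support_twMode hT k)

theorem twCoeff_apply (k : ℤ) (u w : V) :
    A.twCoeff hT k u w =
      ∑ᶠ p : ℤ, (logDivTwoPiI ^ (-p - 1)).coeff k • A.twMode hT p u w := rfl

theorem twCoeff_eq_sum {k a b : ℤ} {u w : V} (ha : a ≤ -1 - k)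
    (hb : ∀ p, b ≤ p → A.twMode hT p u w = 0) :
    A.twCoeff hT k u w =
      ∑ p ∈ Finset.Ico a b, (logDivTwoPiI ^ (-p - 1)).coeff k • A.twMode hT p u w := by
  rw [twCoeff_apply]
  refine sum_Ico_eq_finsum (fun p hp => ?_) (fun p hp => ?_)
  · rw [coeff_logDivTwoPiI_zpow_of_lt (by omega), zero_smul]
  · rw [hb p hp, smul_zero]

theorem coeffY_onePlusPow (u w : V) (k : ℤ) :
    A.coeffY (onePlusPow T u) logDivTwoPiI w k = A.twCoeff hT k u w := by
  obtain ⟨N, hN⟩ := A.exists_mode_pow_eq_zero hT u w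
  have htw : ∀ p : ℤ, (N : ℤ) ≤ p → A.twMode hT p u w = 0 := fun p hp => by
    rw [A.twMode_eq_sum hT (M := 0) fun j _ => hN j _ (by omega), Finset.sum_range_zero]
  obtain ⟨J, hJ⟩ : ∃ J : ℕ, J = (N + k + 1).toNat := ⟨_, rfl⟩
  have hmode : ∀ (n : ℤ) (j : ℕ), (N : ℤ) ≤ n → A.mode n (onePlusPow T u j) w = 0 := by
    intro n j hn
    rw [onePlusPow_eq_sum T u (Nat.lt_succ_self j), map_sum, LinearMap.sum_apply]
    refine Finset.sum_eq_zero fun i _ => ?_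
    rw [map_smul, LinearMap.smul_apply, hN i n hn, smul_zero]
  have hL : A.coeffY (onePlusPow T u) logDivTwoPiI w k =
      ∑ x ∈ Finset.Ico (-1 - k) N ×ˢ Finset.range J,
        (logDivTwoPiI ^ (-x.1 - 1)).coeff (k - x.2) • A.mode x.1 (onePlusPow T u x.2) w := by
    refine finsum_eq_sum_of_support_subset _ fun x hx => ?_
    by_contra h
    refine hx ?_
    simp only [vertexMode_eq_mode]
    rw [Finset.mem_coe, Finset.mem_product, Finset.mem_Ico, Finset.mem_range] at h
    by_cases h1 : (N : ℤ) ≤ x.1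
    · rw [hmode _ _ h1, smul_zero]
    · rw [coeff_logDivTwoPiI_zpow_of_lt (by omega), zero_smul]
  have hR : ∀ p ∈ Finset.Ico (-1 - k) (N : ℤ), (logDivTwoPiI ^ (-p - 1)).coeff k •
      A.twMode hT p u w = ∑ i ∈ Finset.range J, (fun n : ℤ => (expKappa i *
        (logDivTwoPiI ^ (-n - 1 + i)).coeff k) • A.mode n ((T ^ i) u) w) (p + i) := by
    intro p hp
    rw [Finset.mem_Ico] at hp
    rw [A.twMode_eq_sum hT (M := J) fun j hj => hN j _ (by omega), Finset.smul_sum]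
    refine Finset.sum_congr rfl fun i _ => ?_
    simp only
    rw [smul_smul, mul_comm, show -(p + (i : ℤ)) - 1 + i = -p - 1 by ring]
  rw [A.twCoeff_eq_sum hT le_rfl htw, Finset.sum_congr rfl hR, Finset.sum_comm, hL,
    Finset.sum_product]
  have hshift : ∀ i : ℕ, ∑ p ∈ Finset.Ico (-1 - k) (N : ℤ), (fun n : ℤ => (expKappa i *
        (logDivTwoPiI ^ (-n - 1 + i)).coeff k) • A.mode n ((T ^ i) u) w) (p + i) =
      ∑ n ∈ Finset.Ico (-1 - k) (N : ℤ), (expKappa i *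
        (logDivTwoPiI ^ (-n - 1 + i)).coeff k) • A.mode n ((T ^ i) u) w := by
    intro i
    rw [← sum_Ico_eq_finsum, ← sum_Ico_eq_finsum]
    · exact finsum_add_right (fun n : ℤ => (expKappa i *
        (logDivTwoPiI ^ (-n - 1 + i)).coeff k) • A.mode n ((T ^ i) u) w) i
    · intro n hn
      rw [coeff_logDivTwoPiI_zpow_of_lt (by omega), mul_zero, zero_smul]
    · intro n hn
      rw [hN i n hn, smul_zero]
    · intro n hn
      simp only
      rw [coeff_logDivTwoPiI_zpow_of_lt (by omega), mul_zero, zero_smul]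
    · intro n hn
      simp only
      rw [hN i _ (by omega), smul_zero]
  rw [Finset.sum_congr rfl fun i _ => hshift i, Finset.sum_comm (s := Finset.range J)]
  refine Finset.sum_congr rfl fun n hn => ?_
  rw [Finset.mem_Ico] at hn
  have hexp : ∀ j ∈ Finset.range J,
      (logDivTwoPiI ^ (-n - 1)).coeff (k - j) • A.mode n (onePlusPow T u j) w =
        ∑ i ∈ Finset.range J, ((logDivTwoPiI ^ (-n - 1)).coeff (k - j) *
          PowerSeries.coeff j (stirlingSeries i)) • A.mode n ((T ^ i) u) w := by
    intro j hj
    rw [onePlusPow_eq_sum T u (Finset.mem_range.1 hj), map_sum, LinearMap.sum_apply,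
      Finset.smul_sum]
    refine Finset.sum_congr rfl fun i _ => ?_
    rw [map_smul, LinearMap.smul_apply, smul_smul]
  rw [Finset.sum_congr rfl hexp, Finset.sum_comm]
  refine Finset.sum_congr rfl fun i _ => ?_
  rw [← Finset.sum_smul, sum_coeff_mul_stirlingSeries _ _ _ (by omega)]

/-- `Y(e^{2πixT} u, x) = Y((1+y)^T u, log(1+y)/(2πi))` has the derivative
`2πi (1+y) d/dy` with respect to `x`. -/
theorem twCoeff_derivative (hL : ∀ u, T (A.mode 0 A.conformal u) = A.mode 0 A.conformal (T u))
    (k : ℤ) (u w : V) :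
    A.twCoeff hT k (A.mode 0 A.conformal u + kappa • T u) w =
      kappa • (((k : ℂ) + 1) • A.twCoeff hT (k + 1) u w + (k : ℂ) • A.twCoeff hT k u w) := by
  obtain ⟨N, hN⟩ := A.exists_twMode_eq_zero hT u w
  have h1 : A.twCoeff hT k (A.mode 0 A.conformal u + kappa • T u) w =
      ∑ᶠ p : ℤ, ((-p - 1 : ℂ) * (logDivTwoPiI ^ (-p - 1 - 1)).coeff k) • A.twMode hT p u w := by
    rw [twCoeff_apply]
    refine (finsum_add_right _ 1).symm.trans (finsum_congr fun p => ?_)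
    rw [A.twMode_derivative hT hL, smul_smul, add_sub_cancel_right,
      show -(p + 1) - 1 = -p - 1 - 1 by ring, mul_comm]
    push_cast
    congr 2
    ring
  rw [h1, A.twCoeff_eq_sum hT (a := -2 - k) (b := N) (by omega) hN,
    A.twCoeff_eq_sum hT (k := k) (a := -2 - k) (b := N) (by omega) hN,
    sum_Ico_eq_finsum (a := -2 - k) (b := N), Finset.smul_sum, Finset.smul_sum,
    ← Finset.sum_add_distrib, Finset.smul_sum]
  · refine Finset.sum_congr rfl fun p _ => ?_
    have := coeff_logDivTwoPiI_zpow_pred (-p - 1) k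
    push_cast at this
    rw [this, smul_smul, smul_smul, ← add_smul, smul_smul]
  · intro p hp
    rw [coeff_logDivTwoPiI_zpow_of_lt (by omega), mul_zero, zero_smul]
  · intro p hp
    rw [hN p hp, smul_zero]

theorem twCoeff_vacuum_left (hvac : T A.vacuum = 0) (w : V) :
    A.twCoeff hT 0 A.vacuum w = w := by
  have h1 : ∀ p : ℤ, A.twMode hT p A.vacuum w = if p = -1 then w else 0 := by
    intro p
    rw [twMode_apply, finsum_eq_single _ 0]
    · have := A.vacuum_mode p w
      rw [vertexMode_eq_mode] at this
      simp [expKappa, this]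
    · intro j hj
      obtain ⟨j, rfl⟩ := Nat.exists_eq_succ_of_ne_zero hj
      rw [Nat.succ_eq_add_one, pow_succ, Module.End.mul_apply, hvac]
      simp
  rw [twCoeff_apply, finsum_eq_single _ (-1)]
  · rw [h1, if_pos rfl]
    simp
  · intro p hp
    rw [h1, if_neg hp, smul_zero]

theorem twCoeff_vacuum_right (u : V) : A.twCoeff hT 0 u A.vacuum = u := by
  have h0 : ∀ (n : ℤ) (x : V), 0 ≤ n → A.mode n x A.vacuum = 0 := by
    intro n x hn
    obtain ⟨m, rfl⟩ := Int.eq_ofNat_of_zero_le hn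
    exact A.mode_vacuum m x
  rw [A.twCoeff_eq_sum hT (a := -1) (b := 0) (by norm_num)]
  · rw [show Finset.Ico (-1 : ℤ) 0 = {-1} from rfl, Finset.sum_singleton,
      A.twMode_eq_sum hT (M := 1) fun j hj => h0 _ _ (by omega)]
    have := A.creation u
    rw [vertexMode_eq_mode] at this
    simp [expKappa, this]
  · intro p hp
    rw [A.twMode_eq_sum hT (M := 0) fun j hj => h0 _ _ (by omega), Finset.sum_range_zero]

/-- The residue operator of `u ∈ V₀` is a derivation of all the products `twCoeff`. -/
theorem twMode_zero_twCoeff {V₀ : Submodule ℂ V} (hV₀ : ∀ u ∈ V₀, T u ∈ V₀)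
    (hD : ∀ u ∈ V₀, ∀ (v : V) (n : ℤ),
      T (A.mode n u v) = A.mode n (T u) v + A.mode n u (T v))
    {u : V} (hu : u ∈ V₀) (v w : V) (k : ℤ) :
    A.twMode hT 0 u (A.twCoeff hT k v w) =
      A.twCoeff hT k (A.twMode hT 0 u v) w + A.twCoeff hT k v (A.twMode hT 0 u w) := by
  obtain ⟨N₁, h₁⟩ := A.exists_twMode_eq_zero hT v w
  obtain ⟨N₂, h₂⟩ := A.exists_twMode_eq_zero hT (A.twMode hT 0 u v) w
  obtain ⟨N₃, h₃⟩ := A.exists_twMode_eq_zero hT v (A.twMode hT 0 u w)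
  rw [A.twCoeff_eq_sum hT (b := N₁ + N₂ + N₃) le_rfl fun p hp => h₁ p (by omega),
    A.twCoeff_eq_sum hT (b := N₁ + N₂ + N₃) le_rfl fun p hp => h₂ p (by omega),
    A.twCoeff_eq_sum hT (b := N₁ + N₂ + N₃) le_rfl fun p hp => h₃ p (by omega),
    map_sum, ← Finset.sum_add_distrib]
  refine Finset.sum_congr rfl fun q _ => ?_
  have h := A.twMode_commutator hT hV₀ hD hu v w 0 q
  rw [finsum_eq_single _ 0] at h
  · rw [map_smul, ← smul_add]
    congr 1
    rw [sub_eq_iff_eq_add] at h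
    simpa using h
  · intro i hi
    rw [Ring.choose_zero_pos ℤ (Nat.pos_of_ne_zero hi)]
    simp

end VertexOperatorAlgebra

/-! ### Commutators with the left multiplications -/

namespace VertexOperatorAlgebra

variable {V : Type*} [AddCommGroup V] [Module ℂ V] (A : VertexOperatorAlgebra V)
  {T : Module.End ℂ V} (hT : LocallyFiniteOp T)

/-- Commutator of the left multiplication by `u ∈ V₀` with the products `twCoeff`. -/
theorem twCoeff_zero_commutator {V₀ : Submodule ℂ V} (hV₀ : ∀ u ∈ V₀, T u ∈ V₀)
    (hD : ∀ u ∈ V₀, ∀ (v : V) (n : ℤ),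
      T (A.mode n u v) = A.mode n (T u) v + A.mode n u (T v))
    {u : V} (hu : u ∈ V₀) (v w : V) (k : ℤ) {I : ℕ}
    (hI : ∀ p : ℤ, I ≤ p → A.twMode hT p u v = 0) :
    A.twCoeff hT 0 u (A.twCoeff hT k v w) - A.twCoeff hT k v (A.twCoeff hT 0 u w) =
      ∑ i ∈ Finset.range I, ∑ n ∈ Finset.Icc (-1 - i : ℤ) 0,
        kernelCoeff i n • A.twCoeff hT (k - n) (A.twMode hT i u v) w := by
  -- finite ranges for all the sums over modes
  choose Ny hNy using fun i : ℕ => A.exists_twMode_eq_zero hT (A.twMode hT i u v) w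
  obtain ⟨N₁, h₁⟩ := A.exists_twMode_eq_zero hT v w
  obtain ⟨N₂, h₂⟩ := A.exists_twMode_eq_zero hT v (A.twCoeff hT 0 u w)
  obtain ⟨N₃, h₃⟩ := A.exists_twMode_eq_zero hT u w
  obtain ⟨N₄, h₄⟩ := A.exists_twMode_eq_zero hT u (A.twCoeff hT k v w)
  obtain ⟨N, hN⟩ : ∃ N : ℕ, ∀ i < I, Ny i ≤ N :=
    ⟨(Finset.range I).sup Ny, fun i hi => Finset.le_sup (f := Ny) (Finset.mem_range.2 hi)⟩
  have hy : ∀ i < I, ∀ s : ℤ, N ≤ s → A.twMode hT s (A.twMode hT i u v) w = 0 :=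
    fun i hi s hs => hNy i s (le_trans (by exact_mod_cast hN i hi) hs)
  obtain ⟨M, hM⟩ : ∃ M : ℤ, M = k.natAbs + N + I + 1 + N₁ + N₂ + N₃ + N₄ := ⟨_, rfl⟩
  set c : ℤ → ℂ := fun p => (logDivTwoPiI ^ (-p - 1)).coeff 0 with hc
  set d : ℤ → ℂ := fun q => (logDivTwoPiI ^ (-q - 1)).coeff k with hd
  have e1 : A.twCoeff hT 0 u (A.twCoeff hT k v w) =
      ∑ p ∈ Finset.Ico (-1) M, ∑ q ∈ Finset.Ico (-1 - k) M,
        (c p * d q) • A.twMode hT p u (A.twMode hT q v w) := by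
    rw [A.twCoeff_eq_sum hT (a := -1) (b := M) (by norm_num) fun p hp => h₄ p (by omega)]
    refine Finset.sum_congr rfl fun p _ => ?_
    rw [A.twCoeff_eq_sum hT (b := M) le_rfl fun p hp => h₁ p (by omega), map_sum, Finset.smul_sum]
    refine Finset.sum_congr rfl fun q _ => ?_
    rw [map_smul, smul_smul]
  have e2 : A.twCoeff hT k v (A.twCoeff hT 0 u w) =
      ∑ p ∈ Finset.Ico (-1) M, ∑ q ∈ Finset.Ico (-1 - k) M,
        (c p * d q) • A.twMode hT q v (A.twMode hT p u w) := by
    rw [A.twCoeff_eq_sum hT (b := M) le_rfl fun p hp => h₂ p (by omega), Finset.sum_comm]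
    refine Finset.sum_congr rfl fun q _ => ?_
    rw [A.twCoeff_eq_sum hT (a := -1) (b := M) (by norm_num) fun p hp => h₃ p (by omega), map_sum,
      Finset.smul_sum]
    refine Finset.sum_congr rfl fun p _ => ?_
    rw [map_smul, smul_smul, mul_comm]
  have e3 : ∀ p q : ℤ, A.twMode hT p u (A.twMode hT q v w) -
      A.twMode hT q v (A.twMode hT p u w) = ∑ i ∈ Finset.range I,
        ((Ring.choose p i : ℤ) : ℂ) • A.twMode hT (q + (p - i)) (A.twMode hT i u v) w := by
    intro p q
    rw [A.twMode_commutator hT hV₀ hD hu, finsum_eq_sum_range (M := I)]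
    · refine Finset.sum_congr rfl fun i _ => ?_
      rw [show p + q - (i : ℤ) = q + (p - i) by ring]
    · intro i hi
      rw [hI i (by omega)]
      simp
  have e4 : ∀ i ∈ Finset.range I, ∀ p ∈ Finset.Ico (-1) M,
      ∑ q ∈ Finset.Ico (-1 - k) M, d q • A.twMode hT (q + (p - i)) (A.twMode hT i u v) w =
      ∑ s ∈ Finset.Ico (-2 - I - k) (N : ℤ), (logDivTwoPiI ^ (p - i - s - 1)).coeff k •
        A.twMode hT s (A.twMode hT i u v) w := by
    intro i hi p hp
    rw [Finset.mem_range] at hi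
    rw [Finset.mem_Ico] at hp
    rw [← sum_Ico_eq_finsum, ← sum_Ico_eq_finsum]
    · refine Eq.trans (finsum_congr fun q => ?_) (finsum_add_right _ (p - (i : ℤ)))
      simp only [hd]
      rw [show p - (i : ℤ) - (q + (p - i)) - 1 = -q - 1 by ring]
    · intro s hs
      rw [coeff_logDivTwoPiI_zpow_of_lt (by omega), zero_smul]
    · intro s hs
      rw [hy i hi s hs, smul_zero]
    · intro q hq
      simp only [hd]
      rw [coeff_logDivTwoPiI_zpow_of_lt (by omega), zero_smul]
    · intro q hq
      rw [hy i hi _ (by omega), smul_zero]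
  calc _ = ∑ i ∈ Finset.range I, ∑ p ∈ Finset.Ico (-1) M, (c p * ((Ring.choose p i : ℤ) : ℂ)) •
        ∑ q ∈ Finset.Ico (-1 - k) M, d q •
          A.twMode hT (q + (p - i)) (A.twMode hT i u v) w := by
        rw [e1, e2, Finset.sum_comm (s := Finset.range I), ← Finset.sum_sub_distrib]
        refine Finset.sum_congr rfl fun p _ => ?_
        simp only [← Finset.sum_sub_distrib, ← smul_sub, e3, Finset.smul_sum, smul_smul]
        rw [Finset.sum_comm]
        refine Finset.sum_congr rfl fun i _ => Finset.sum_congr rfl fun q _ => ?_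
        congr 1
        ring
    _ = ∑ i ∈ Finset.range I, ∑ s ∈ Finset.Ico (-2 - I - k) (N : ℤ),
        (∑ p ∈ Finset.Ico (-1) M, c p * ((Ring.choose p i : ℤ) : ℂ) *
          (logDivTwoPiI ^ (p - i - s - 1)).coeff k) •
            A.twMode hT s (A.twMode hT i u v) w := by
        refine Finset.sum_congr rfl fun i hi => ?_
        rw [Finset.sum_congr rfl fun p hp => by rw [e4 i hi p hp]]
        simp only [Finset.sum_smul, Finset.smul_sum, smul_smul]
        rw [Finset.sum_comm]
    _ = _ := by
        refine Finset.sum_congr rfl fun i hi => ?_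
        rw [Finset.mem_range] at hi
        have e5 : ∀ n ∈ Finset.Icc (-1 - i : ℤ) 0,
            kernelCoeff i n • A.twCoeff hT (k - n) (A.twMode hT i u v) w =
            ∑ s ∈ Finset.Ico (-2 - I - k) (N : ℤ), (kernelCoeff i n *
              (logDivTwoPiI ^ (-s - 1)).coeff (k - n)) •
                A.twMode hT s (A.twMode hT i u v) w := by
          intro n hn
          rw [Finset.mem_Icc] at hn
          rw [A.twCoeff_eq_sum hT (a := -2 - I - k) (by omega) (hy i hi), Finset.smul_sum]
          simp only [smul_smul]
        rw [Finset.sum_congr rfl e5, Finset.sum_comm]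
        refine Finset.sum_congr rfl fun s hs => ?_
        rw [Finset.mem_Ico] at hs
        rw [sum_kernel_mul M i s k (by omega), Finset.sum_smul]

/-- Modulo the products of higher order in `y`, the commutator with the left multiplication by
`u ∈ V₀` is given by the residue operator of `u`. -/
theorem twCoeff_zero_commutator_mem {V₀ : Submodule ℂ V} (hV₀ : ∀ u ∈ V₀, T u ∈ V₀)
    (hD : ∀ u ∈ V₀, ∀ (v : V) (n : ℤ),
      T (A.mode n u v) = A.mode n (T u) v + A.mode n u (T v))
    {u : V} (hu : u ∈ V₀) (v w : V) (k : ℤ) {O : Submodule ℂ V}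
    (hO : ∀ k' : ℤ, k < k' → ∀ x y : V, A.twCoeff hT k' x y ∈ O) :
    A.twCoeff hT 0 u (A.twCoeff hT k v w) - A.twCoeff hT k v (A.twCoeff hT 0 u w) -
      kappa • A.twCoeff hT k (A.twMode hT 0 u v) w ∈ O := by
  obtain ⟨I, hI⟩ := A.exists_twMode_eq_zero hT u v
  rw [A.twCoeff_zero_commutator hT hV₀ hD hu v w k (I := I + 1) fun p hp => hI p (by omega),
    Finset.sum_range_succ']
  have h0 : ∑ n ∈ Finset.Icc (-1 - (0 : ℕ) : ℤ) 0,
      kernelCoeff 0 n • A.twCoeff hT (k - n) (A.twMode hT (0 : ℕ) u v) w =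
      kappa • A.twCoeff hT (k + 1) (A.twMode hT 0 u v) w +
        kappa • A.twCoeff hT k (A.twMode hT 0 u v) w := by
    rw [show Finset.Icc (-1 - (0 : ℕ) : ℤ) 0 = {-1, 0} from rfl,
      Finset.sum_pair (by norm_num)]
    simp [kernelCoeff]
  rw [h0, ← add_assoc, add_sub_cancel_right]
  refine O.add_mem (O.sum_mem fun i _ => O.sum_mem fun n hn => ?_)
    (O.smul_mem _ (hO _ (by omega) _ _))
  rw [Finset.mem_Icc] at hn
  rcases hn.2.eq_or_lt with h | h
  · rw [h, kernelCoeff_succ_zero, zero_smul]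
    exact O.zero_mem
  · exact O.smul_mem _ (hO _ (by omega) _ _)

end VertexOperatorAlgebra

/-! ### Logarithms of locally unipotent operators -/

/-- The binomial polynomial `X (X - 1) ⋯ (X - k + 1) / k!`. -/
def binomialPoly (k : ℕ) : Polynomial ℂ :=
  Polynomial.C ((k.factorial : ℂ)⁻¹) * descPochhammer ℂ k

theorem eval_binomialPoly (k s : ℕ) : (binomialPoly k).eval (s : ℂ) = (s.choose k : ℂ) := by
  have h : (k.factorial : ℂ) ≠ 0 := by exact_mod_cast k.factorial_ne_zero
  rw [binomialPoly, Polynomial.eval_mul, Polynomial.eval_C, descPochhammer_eval_eq_descFactorial,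
    Nat.descFactorial_eq_factorial_mul_choose]
  push_cast
  field_simp

theorem coeff_binomialPoly (k i : ℕ) :
    (binomialPoly k).coeff i = PowerSeries.coeff k (stirlingSeries i) := by
  rw [binomialPoly, Polynomial.coeff_C_mul, stirlingSeries, PowerSeries.coeff_mk]

theorem coeff_zero_binomialPoly (k : ℕ) : (binomialPoly k).coeff 0 = if k = 0 then 1 else 0 := by
  rw [coeff_binomialPoly, stirlingSeries_zero, PowerSeries.coeff_one]

theorem coeff_one_binomialPoly (k : ℕ) :
    (binomialPoly k).coeff 1 = PowerSeries.coeff k (PowerSeries.log ℂ) := by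
  rw [coeff_binomialPoly, stirlingSeries_eq]
  simp

section Unipotent

variable {V : Type*} [AddCommGroup V] [Module ℂ V]

theorem pow_apply_eq_zero_of_le {M : Module.End ℂ V} {x : V} {K k : ℕ} (h : (M ^ K) x = 0)
    (hk : K ≤ k) : (M ^ k) x = 0 := by
  rw [← Nat.sub_add_cancel hk, pow_add, Module.End.mul_apply, h, map_zero]

theorem pow_one_add_apply {M : Module.End ℂ V} {x : V} {K : ℕ} (h : (M ^ K) x = 0) (s : ℕ) :
    ((1 + M) ^ s) x = ∑ k ∈ Finset.range K, (s.choose k : ℂ) • (M ^ k) x := by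
  rw [add_comm 1 M, (Commute.one_right M).add_pow, LinearMap.sum_apply]
  have h1 : ∀ k ∈ Finset.range (s + 1), (M ^ k * 1 ^ (s - k) * (s.choose k : Module.End ℂ V)) x =
      (s.choose k : ℂ) • (M ^ k) x := by
    intro k _
    rw [one_pow, mul_one, ← Nat.cast_comm, Module.End.mul_apply, Module.End.natCast_apply,
      Nat.cast_smul_eq_nsmul]
  rw [Finset.sum_congr rfl h1]
  have hz : ∀ k, (s < k ∨ K ≤ k) → (s.choose k : ℂ) • (M ^ k) x = 0 := by
    rintro k (hk | hk)
    · rw [Nat.choose_eq_zero_of_lt hk]; simp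
    · rw [pow_apply_eq_zero_of_le h hk, smul_zero]
  rw [← Finset.sum_subset (s₁ := Finset.range (min (s + 1) K)),
    ← Finset.sum_subset (s₁ := Finset.range (min (s + 1) K)) (s₂ := Finset.range K)]
  · exact Finset.range_subset_range.2 (min_le_right _ _)
  · intro k hk hk'
    rw [Finset.mem_range] at hk hk'
    exact hz k (by omega)
  · exact Finset.range_subset_range.2 (min_le_left _ _)
  · intro k hk hk'
    rw [Finset.mem_range] at hk hk'
    exact hz k (by omega)

theorem logOnePlus_eq_sum {M : Module.End ℂ V} (hM : ∀ v, ∃ j : ℕ, (M ^ j) v = 0) {x : V} {K : ℕ}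
    (h : (M ^ K) x = 0) :
    logOnePlus M hM x =
      ∑ k ∈ Finset.range K, PowerSeries.coeff k (PowerSeries.log ℂ) • (M ^ k) x := by
  have h1 : logOnePlus M hM x = ∑ᶠ j : ℕ, ((-1 : ℂ) ^ j / ((j : ℂ) + 1)) • (M ^ (j + 1)) x := rfl
  rw [h1, finsum_eq_sum_range (M := K)]
  · have h2 : ∑ k ∈ Finset.range K, PowerSeries.coeff k (PowerSeries.log ℂ) • (M ^ k) x =
        ∑ k ∈ Finset.range (K + 1), PowerSeries.coeff k (PowerSeries.log ℂ) • (M ^ k) x := by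
      rw [Finset.sum_range_succ, h, smul_zero, add_zero]
    rw [h2, Finset.sum_range_succ']
    simp only [PowerSeries.coeff_log, if_true, zero_smul, add_zero, if_neg (Nat.succ_ne_zero _)]
    refine Finset.sum_congr rfl fun j _ => ?_
    congr 1
    simp [pow_succ]
  · intro j hj
    rw [pow_apply_eq_zero_of_le h (by omega), smul_zero]

/-- The logarithm of a locally unipotent operator that is multiplicative for a bilinear product
`B : V × V → V` is a derivation of `B`: the identity `(1+M)ˢ B(u, v) = B((1+M)ˢ u, (1+M)ˢ v)` is
polynomial in `s ∈ ℕ`, and the assertion is the comparison of the coefficients of `s`. -/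
theorem logOnePlus_apply_bilin {M : Module.End ℂ V} (hM : ∀ v, ∃ j : ℕ, (M ^ j) v = 0)
    (B : V →ₗ[ℂ] V →ₗ[ℂ] V) (hB : ∀ u v, (1 + M) (B u v) = B ((1 + M) u) ((1 + M) v)) (u v : V) :
    logOnePlus M hM (B u v) = B (logOnePlus M hM u) v + B u (logOnePlus M hM v) := by
  obtain ⟨K₁, h₁⟩ := hM u
  obtain ⟨K₂, h₂⟩ := hM v
  obtain ⟨K₃, h₃⟩ := hM (B u v)
  obtain ⟨K, hK⟩ : ∃ K : ℕ, K = K₁ + K₂ + K₃ + 1 := ⟨_, rfl⟩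
  replace h₁ := pow_apply_eq_zero_of_le h₁ (by omega : K₁ ≤ K)
  replace h₂ := pow_apply_eq_zero_of_le h₂ (by omega : K₂ ≤ K)
  replace h₃ := pow_apply_eq_zero_of_le h₃ (by omega : K₃ ≤ K)
  have hpow : ∀ s : ℕ, ((1 + M) ^ s) (B u v) = B (((1 + M) ^ s) u) (((1 + M) ^ s) v) := by
    intro s
    induction s with
    | zero => simp
    | succ s ih => simp only [pow_succ', Module.End.mul_apply, ih, hB]
  rw [← sub_eq_zero, ← Module.forall_dual_apply_eq_zero_iff ℂ]
  intro lam
  rw [map_sub, sub_eq_zero]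
  set P : Polynomial ℂ := ∑ k ∈ Finset.range K, Polynomial.C (lam ((M ^ k) (B u v))) * binomialPoly k
    with hP
  set Q : Polynomial ℂ := ∑ k ∈ Finset.range K, ∑ l ∈ Finset.range K,
    Polynomial.C (lam (B ((M ^ k) u) ((M ^ l) v))) * (binomialPoly k * binomialPoly l) with hQ
  have heval : ∀ s : ℕ, P.eval (s : ℂ) = Q.eval (s : ℂ) := by
    intro s
    have h := congrArg lam (hpow s)
    rw [pow_one_add_apply h₁, pow_one_add_apply h₂, pow_one_add_apply h₃] at h
    simp only [map_sum, map_smul, LinearMap.sum_apply, LinearMap.smul_apply, smul_eq_mul] at h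
    rw [hP, hQ]
    simp only [Polynomial.eval_finsetSum, Polynomial.eval_mul, Polynomial.eval_C,
      eval_binomialPoly]
    rw [Finset.sum_comm]
    refine Eq.trans (Finset.sum_congr rfl fun k _ => mul_comm _ _) (h.trans ?_)
    refine Finset.sum_congr rfl fun l _ => ?_
    rw [Finset.mul_sum]
    refine Finset.sum_congr rfl fun k _ => ?_
    ring
  have hPQ : P = Q := by
    refine Polynomial.eq_of_infinite_eval_eq P Q
      ((Set.infinite_range_of_injective (Nat.cast_injective (R := ℂ))).mono ?_)
    rintro _ ⟨s, rfl⟩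
    exact heval s
  have h := congrArg (fun R : Polynomial ℂ => R.coeff 1) hPQ
  simp only [hP, hQ, Polynomial.finsetSum_coeff, Polynomial.coeff_C_mul] at h
  simp only [Polynomial.mul_coeff_one, coeff_zero_binomialPoly, coeff_one_binomialPoly, mul_add, Finset.sum_add_distrib] at h
  rw [logOnePlus_eq_sum hM h₁, logOnePlus_eq_sum hM h₂, logOnePlus_eq_sum hM h₃]
  simp only [map_sum, map_add, map_smul, LinearMap.sum_apply, LinearMap.smul_apply, smul_eq_mul]
  have hK0 : 0 ∈ Finset.range K := Finset.mem_range.2 (by omega)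
  refine Eq.trans (Finset.sum_congr rfl fun k _ => mul_comm _ _) (h.trans ?_)
  rw [add_comm]
  congr 1
  · refine Finset.sum_congr rfl fun k _ => ?_
    rw [Finset.sum_eq_single_of_mem 0 hK0]
    · simp [mul_comm]
    · intro l _ hl
      simp [hl]
  · rw [Finset.sum_eq_single_of_mem 0 hK0]
    · refine Finset.sum_congr rfl fun l _ => ?_
      simp [mul_comm]
    · intro k _ hk
      simp [hk]

theorem pow_logOnePlus_apply_eq_zero {M : Module.End ℂ V} (hM : ∀ v, ∃ j : ℕ, (M ^ j) v = 0)
    (K : ℕ) {x : V} (h : (M ^ K) x = 0) : ((logOnePlus M hM) ^ K) x = 0 := by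
  induction K generalizing x with
  | zero => simpa using h
  | succ K ih =>
    rw [pow_succ, Module.End.mul_apply]
    apply ih
    rw [logOnePlus_eq_sum hM h, map_sum]
    refine Finset.sum_eq_zero fun k _ => ?_
    rw [map_smul, ← Module.End.mul_apply, ← pow_add]
    rcases k with _ | k
    · simp
    · rw [pow_apply_eq_zero_of_le h (by omega), smul_zero]

theorem logOnePlus_mem {M : Module.End ℂ V} (hM : ∀ v, ∃ j : ℕ, (M ^ j) v = 0)
    {S : Submodule ℂ V} (hS : ∀ x ∈ S, M x ∈ S) {x : V} (hx : x ∈ S) : logOnePlus M hM x ∈ S := by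
  obtain ⟨K, hK⟩ := hM x
  rw [logOnePlus_eq_sum hM hK]
  exact S.sum_mem fun k _ => S.smul_mem _ (pow_apply_mem_of_stable hS k hx)

end Unipotent

/-! ### The grading by `g`-weights and the operator `𝓛 - L(0) + 𝓝` -/

namespace VertexOperatorAlgebra.Automorphism

variable {V : Type*} [AddCommGroup V] [Module ℂ V] {A : VertexOperatorAlgebra V}
  (g : A.Automorphism)

theorem op_mode (n : ℤ) (u v : V) : g.op (A.mode n u v) = A.mode n (g.op u) (g.op v) :=
  g.map_mode u v n

/-- The eigenvalue `e^{2πia}` of `σ` on `V^{[a + ℤ]}`. -/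
def eigenval (a : ℂ) : ℂ := Complex.exp (2 * Real.pi * Complex.I * a)

theorem eigenval_ne_zero (a : ℂ) : eigenval a ≠ 0 := Complex.exp_ne_zero _

theorem eigenval_add (a b : ℂ) : eigenval (a + b) = eigenval a * eigenval b := by
  rw [eigenval, mul_add, Complex.exp_add]
  rfl

theorem mem_genSpace_iff {a : ℂ} {x : V} :
    x ∈ g.genSpace a ↔ ∃ k : ℕ, ((g.op - eigenval a • (1 : Module.End ℂ V)) ^ k) x = 0 :=
  Module.End.mem_maxGenEigenspace _ _ _

theorem genSpace_congr {a b : ℂ} (h : eigenval a = eigenval b) : g.genSpace a = g.genSpace b := by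
  change Module.End.maxGenEigenspace g.op (eigenval a) =
    Module.End.maxGenEigenspace g.op (eigenval b)
  rw [h]

/-- `V^{[a + ℤ]}ₙ V^{[b + ℤ]} ⊆ V^{[a + b + ℤ]}`. -/
theorem mode_mem_genSpace {a b : ℂ} {u v : V} (hu : u ∈ g.genSpace a) (hv : v ∈ g.genSpace b)
    (n : ℤ) : A.mode n u v ∈ g.genSpace (a + b) := by
  rw [mem_genSpace_iff] at hu hv
  obtain ⟨k, hk⟩ := hu
  obtain ⟨l, hl⟩ := hv
  obtain ⟨m, hm⟩ : ∃ m, m = k + l := ⟨_, rfl⟩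
  induction m generalizing k l u v with
  | zero =>
    obtain rfl : k = 0 := by omega
    rw [pow_zero, Module.End.one_apply] at hk
    rw [hk, map_zero, LinearMap.zero_apply]
    exact zero_mem _
  | succ m ih =>
    rcases k with _ | k
    · rw [pow_zero, Module.End.one_apply] at hk
      rw [hk, map_zero, LinearMap.zero_apply]
      exact zero_mem _
    rcases l with _ | l
    · rw [pow_zero, Module.End.one_apply] at hl
      rw [hl, map_zero]
      exact zero_mem _
    have hcomm : ∀ (z : ℂ), Commute g.op (g.op - z • (1 : Module.End ℂ V)) := fun z =>
      (Commute.refl _).sub_right ((Commute.one_right _).smul_right z)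
    have h1 : (g.op - eigenval (a + b) • (1 : Module.End ℂ V)) (A.mode n u v) =
        A.mode n ((g.op - eigenval a • (1 : Module.End ℂ V)) u) (g.op v) +
          eigenval a • A.mode n u ((g.op - eigenval b • (1 : Module.End ℂ V)) v) := by
      simp only [LinearMap.sub_apply, LinearMap.smul_apply, Module.End.one_apply, op_mode, map_sub,
        map_smul, eigenval_add, mul_smul, smul_sub]
      abel
    have h2 : A.mode n ((g.op - eigenval a • (1 : Module.End ℂ V)) u) (g.op v) ∈
        g.genSpace (a + b) := by
      refine ih k ?_ (l + 1) ?_ (by omega)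
      · rw [← Module.End.mul_apply, ← pow_succ, hk]
      · rw [← Module.End.mul_apply, ← ((hcomm _).pow_right _).eq, Module.End.mul_apply, hl, map_zero]
    have h3 : A.mode n u ((g.op - eigenval b • (1 : Module.End ℂ V)) v) ∈ g.genSpace (a + b) := by
      refine ih (k + 1) hk l ?_ (by omega)
      rw [← Module.End.mul_apply, ← pow_succ, hl]
    have h4 := (g.genSpace (a + b)).add_mem h2 ((g.genSpace (a + b)).smul_mem (eigenval a) h3)
    rw [← h1, mem_genSpace_iff] at h4
    obtain ⟨j, hj⟩ := h4
    rw [mem_genSpace_iff]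
    exact ⟨j + 1, by rw [pow_succ, Module.End.mul_apply, hj]⟩

theorem genSpace_induction {P : V → Prop} (hmem : ∀ (a : Strip), ∀ x ∈ g.genSpace a, P x)
    (hadd : ∀ x y, P x → P y → P (x + y)) (v : V) : P v := by
  have hv : v ∈ ⨆ a : Strip, g.genSpace a := by
    rw [g.isInternal_genSpace.submodule_iSup_eq_top]; trivial
  induction hv using Submodule.iSup_induction' with
  | mem a x hx => exact hmem a x hx
  | zero => exact hmem ⟨0, by simp⟩ 0 (zero_mem _)
  | add x y _ _ hx hy => exact hadd x y hx hy

theorem unipotentPart_apply {a : ℂ} {x : V} (hx : x ∈ g.genSpace a) :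
    g.unipotentPart x = (eigenval a)⁻¹ • g.op x := by
  obtain ⟨b, hb⟩ := Strip.exists_exp_eq (eigenval_ne_zero a)
  rw [g.genSpace_congr (b := b) hb.symm] at hx
  rw [unipotentPart, Module.End.mul_apply, g.scalarOp_apply _ b (g.op_mem_genSpace b hx), hb]

theorem unipotentPart_mode (n : ℤ) (u v : V) :
    g.unipotentPart (A.mode n u v) = A.mode n (g.unipotentPart u) (g.unipotentPart v) := by
  refine g.genSpace_induction (P := fun u => g.unipotentPart (A.mode n u v) =
    A.mode n (g.unipotentPart u) (g.unipotentPart v)) (fun a u hu => ?_) (fun x y hx hy => ?_) u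
  · refine g.genSpace_induction (P := fun v => g.unipotentPart (A.mode n u v) =
      A.mode n (g.unipotentPart u) (g.unipotentPart v)) (fun b v hv => ?_) (fun x y hx hy => ?_) v
    · rw [g.unipotentPart_apply (g.mode_mem_genSpace hu hv n), g.unipotentPart_apply hu,
        g.unipotentPart_apply hv, op_mode, eigenval_add, map_smul, map_smul, LinearMap.smul_apply,
        smul_smul, mul_inv, mul_comm]
    · simp only [map_add, hx, hy]
  · simp only [map_add, LinearMap.add_apply, hx, hy]

/-- `𝓝` is a derivation. -/
theorem nilOp_mode (n : ℤ) (u v : V) :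
    g.nilOp (A.mode n u v) = A.mode n (g.nilOp u) v + A.mode n u (g.nilOp v) := by
  have h := logOnePlus_apply_bilin g.unipotentPart_sub_one (A.mode n) (fun u v => by
    rw [add_sub_cancel]; exact g.unipotentPart_mode n u v) u v
  rw [nilOp, LinearMap.smul_apply, LinearMap.smul_apply, LinearMap.smul_apply, h, smul_add, map_smul,
    map_smul, LinearMap.smul_apply]

theorem nilOp_mem_genSpace {a : ℂ} {x : V} (hx : x ∈ g.genSpace a) : g.nilOp x ∈ g.genSpace a := by
  refine (g.genSpace a).smul_mem _ (logOnePlus_mem _ (fun y hy => ?_) hx)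
  rw [LinearMap.sub_apply, g.unipotentPart_apply hy, Module.End.one_apply]
  exact (g.genSpace a).sub_mem ((g.genSpace a).smul_mem _ (g.op_mem_genSpace a hy)) hy

theorem exists_nilOp_pow_eq_zero (x : V) : ∃ k : ℕ, (g.nilOp ^ k) x = 0 := by
  obtain ⟨k, hk⟩ := g.unipotentPart_sub_one x
  refine ⟨k, ?_⟩
  rw [nilOp, smul_pow, LinearMap.smul_apply, pow_logOnePlus_apply_eq_zero _ k hk, smul_zero]

theorem mem_genSpace_zero_of_fixed {x : V} (hx : g.op x = x) : x ∈ g.genSpace 0 := by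
  rw [mem_genSpace_iff]
  exact ⟨1, by simp [eigenval, hx]⟩

theorem nilOp_eq_zero_of_fixed {x : V} (hx : g.op x = x) : g.nilOp x = 0 := by
  have h : ((g.unipotentPart - 1 : Module.End ℂ V) ^ 1) x = 0 := by
    rw [pow_one, LinearMap.sub_apply, g.unipotentPart_apply (g.mem_genSpace_zero_of_fixed hx), hx]
    simp [eigenval]
  rw [nilOp, LinearMap.smul_apply, logOnePlus_eq_sum _ h]
  simp

/-- The scalar `l(u) - wt u` by which `𝓛 - L(0)` acts on `V^{[a + ℤ]}`. -/
def ellShift (a : Strip) : ℂ := if (a : ℂ).re = 0 then (a : ℂ) else (a : ℂ) - 1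

/-- The operator `𝓛 - L(0) + 𝓝`. -/
def twOp : Module.End ℂ V := g.ellOp - A.L 0 + g.nilOp

theorem twOp_eq : g.twOp = g.scalarOp ellShift + g.nilOp := by
  rw [twOp, ellOp, add_sub_cancel_left]
  rfl

theorem twOp_apply (a : Strip) {x : V} (hx : x ∈ g.genSpace a) :
    g.twOp x = ellShift a • x + g.nilOp x := by
  rw [twOp_eq, LinearMap.add_apply, g.scalarOp_apply _ a hx]

theorem twOp_apply_of_re_eq_zero {a : ℂ} (ha : a.re = 0) {x : V} (hx : x ∈ g.genSpace a) :
    g.twOp x = a • x + g.nilOp x := by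
  have := g.twOp_apply ⟨a, by simp [ha]⟩ hx
  rwa [ellShift, if_pos ha] at this

theorem twOp_mem_genSpace (a : Strip) {x : V} (hx : x ∈ g.genSpace a) :
    g.twOp x ∈ g.genSpace a := by
  rw [g.twOp_apply a hx]
  exact add_mem (Submodule.smul_mem _ _ hx) (g.nilOp_mem_genSpace hx)

/-- The sum of the spaces `V^{[a + ℤ]}` with `a` imaginary. -/
def imagPart : Submodule ℂ V := ⨆ a : {a : ℂ // a.re = 0}, g.genSpace a

/-- The sum of the spaces `V^{[a + ℤ]}` with `0 < Re a < 1`. -/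
def nonimagPart : Submodule ℂ V := ⨆ a : {a : ℂ // 0 < a.re ∧ a.re < 1}, g.genSpace a

theorem genSpace_le_imagPart {a : ℂ} (ha : a.re = 0) : g.genSpace a ≤ g.imagPart :=
  le_iSup (fun a : {a : ℂ // a.re = 0} => g.genSpace a) ⟨a, ha⟩

theorem genSpace_le_nonimagPart {a : ℂ} (ha : 0 < a.re) (ha' : a.re < 1) :
    g.genSpace a ≤ g.nonimagPart :=
  le_iSup (fun a : {a : ℂ // 0 < a.re ∧ a.re < 1} => g.genSpace a) ⟨a, ha, ha'⟩

theorem imagPart_induction {P : V → Prop} (hmem : ∀ a : ℂ, a.re = 0 → ∀ x ∈ g.genSpace a, P x)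
    (hadd : ∀ x y, P x → P y → P (x + y)) {v : V} (hv : v ∈ g.imagPart) : P v := by
  induction hv using Submodule.iSup_induction' with
  | mem a x hx => exact hmem a a.2 x hx
  | zero => exact hmem 0 rfl 0 (zero_mem _)
  | add x y _ _ hx hy => exact hadd x y hx hy

theorem nonimagPart_induction {P : V → Prop}
    (hmem : ∀ a : ℂ, 0 < a.re → a.re < 1 → ∀ x ∈ g.genSpace a, P x)
    (hadd : ∀ x y, P x → P y → P (x + y)) {v : V} (hv : v ∈ g.nonimagPart) : P v := by
  induction hv using Submodule.iSup_induction' with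
  | mem a x hx => exact hmem a a.2.1 a.2.2 x hx
  | zero => exact hmem (1 / 2 : ℝ) (by norm_num) (by norm_num) 0 (zero_mem _)
  | add x y _ _ hx hy => exact hadd x y hx hy

theorem exists_add_eq (v : V) : ∃ x ∈ g.imagPart, ∃ y ∈ g.nonimagPart, x + y = v := by
  refine g.genSpace_induction (P := fun v => ∃ x ∈ g.imagPart, ∃ y ∈ g.nonimagPart, x + y = v)
    (fun a v hv => ?_) ?_ v
  · rcases a.2.1.eq_or_lt with h | h
    · exact ⟨v, g.genSpace_le_imagPart h.symm hv, 0, zero_mem _, add_zero v⟩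
    · exact ⟨0, zero_mem _, v, g.genSpace_le_nonimagPart h a.2.2 hv, zero_add v⟩
  · rintro _ _ ⟨x, hx, y, hy, rfl⟩ ⟨x', hx', y', hy', rfl⟩
    exact ⟨x + x', add_mem hx hx', y + y', add_mem hy hy', by abel⟩

theorem mode_mem_nonimagPart {u v : V} (hu : u ∈ g.imagPart) (hv : v ∈ g.nonimagPart) (n : ℤ) :
    A.mode n u v ∈ g.nonimagPart := by
  refine g.imagPart_induction (P := fun u => A.mode n u v ∈ g.nonimagPart) (fun a ha u hu => ?_)
    (fun x y hx hy => ?_) hu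
  · refine g.nonimagPart_induction (P := fun v => A.mode n u v ∈ g.nonimagPart)
      (fun b hb hb' v hv => ?_) (fun x y hx hy => ?_) hv
    · exact g.genSpace_le_nonimagPart (by simpa [ha] using hb) (by simpa [ha] using hb')
        (g.mode_mem_genSpace hu hv n)
    · rw [map_add]; exact add_mem hx hy
  · rw [map_add, LinearMap.add_apply]; exact add_mem hx hy

theorem twOp_mem_imagPart : ∀ u ∈ g.imagPart, g.twOp u ∈ g.imagPart := fun _ hu =>
  g.imagPart_induction (P := fun u => g.twOp u ∈ g.imagPart)
    (fun a ha x hx => g.genSpace_le_imagPart ha (g.twOp_mem_genSpace ⟨a, by simp [ha]⟩ hx))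
    (fun x y hx hy => by rw [map_add]; exact add_mem hx hy) hu

/-- On products with a first factor of imaginary weight, `𝓛 - L(0) + 𝓝` acts by derivations. This
fails for general factors, as the real part of a weight may exceed `0` after an addition. -/
theorem twOp_mode : ∀ u ∈ g.imagPart, ∀ (v : V) (n : ℤ),
    g.twOp (A.mode n u v) = A.mode n (g.twOp u) v + A.mode n u (g.twOp v) := by
  intro u hu v n
  refine g.imagPart_induction (P := fun u => g.twOp (A.mode n u v) =
    A.mode n (g.twOp u) v + A.mode n u (g.twOp v)) (fun a ha u hu => ?_) (fun x y hx hy => ?_) hu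
  · refine g.genSpace_induction (P := fun v => g.twOp (A.mode n u v) =
      A.mode n (g.twOp u) v + A.mode n u (g.twOp v)) (fun b v hv => ?_) (fun x y hx hy => ?_) v
    · have hre : (a + (b : ℂ)).re = (b : ℂ).re := by simp [ha]
      have hab : ellShift ⟨a + b, by rw [hre]; exact b.2⟩ = a + ellShift b := by
        unfold ellShift
        simp only [hre]
        split_ifs <;> ring
      rw [g.twOp_apply ⟨a + b, by rw [hre]; exact b.2⟩ (g.mode_mem_genSpace hu hv n),
        g.twOp_apply_of_re_eq_zero ha hu, g.twOp_apply b hv, nilOp_mode, hab, map_add, map_add,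
        map_smul, map_smul, LinearMap.add_apply, LinearMap.smul_apply, add_smul]
      abel
    · simp only [map_add, hx, hy]
      abel
  · simp only [map_add, LinearMap.add_apply, hx, hy]
    abel

theorem twOp_eq_zero_of_fixed {x : V} (hx : g.op x = x) : g.twOp x = 0 := by
  rw [g.twOp_apply_of_re_eq_zero Complex.zero_re (g.mem_genSpace_zero_of_fixed hx),
    g.nilOp_eq_zero_of_fixed hx, zero_smul, add_zero]

theorem conformal_mem_imagPart : A.conformal ∈ g.imagPart :=
  g.genSpace_le_imagPart Complex.zero_re (g.mem_genSpace_zero_of_fixed g.map_conformal)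

theorem twOp_mode_conformal (n : ℤ) (x : V) :
    g.twOp (A.mode n A.conformal x) = A.mode n A.conformal (g.twOp x) := by
  rw [g.twOp_mode _ g.conformal_mem_imagPart, g.twOp_eq_zero_of_fixed g.map_conformal]
  simp

/-- The weight spaces `V_(n)` are finite-dimensional and stable under `𝓛 - L(0) + 𝓝`. -/
theorem locallyFiniteOp_twOp : LocallyFiniteOp g.twOp := by
  intro u
  have hu : u ∈ ⨆ n : ℤ, Module.End.eigenspace (vertexMode A.Y A.conformal 1) (n : ℂ) := by
    rw [A.isInternal_weight.submodule_iSup_eq_top]; trivial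
  induction hu using Submodule.iSup_induction' with
  | mem n x hx =>
    have := A.finiteDimensional_weight n
    refine ⟨_, Module.Finite.iff_fg.1 this, hx, fun y hy => ?_⟩
    rw [Module.End.mem_eigenspace_iff, vertexMode_eq_mode] at hy ⊢
    rw [← twOp_mode_conformal, hy, map_smul]
  | zero => exact ⟨⊥, Submodule.fg_bot, zero_mem _, fun x hx => by
      rw [Submodule.mem_bot] at hx ⊢; rw [hx, map_zero]⟩
  | add x y _ _ hx hy =>
    obtain ⟨S, hS, hxS, hTS⟩ := hx
    obtain ⟨S', hS', hyS, hTS'⟩ := hy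
    refine ⟨S ⊔ S', hS.sup hS', Submodule.add_mem_sup hxS hyS, fun z hz => ?_⟩
    obtain ⟨a, ha, b, hb, rfl⟩ := Submodule.mem_sup.1 hz
    rw [map_add]
    exact Submodule.add_mem_sup (hTS a ha) (hTS' b hb)

end VertexOperatorAlgebra.Automorphism

/-! ### The ideal `Õ_g(V)` and the quotient algebra -/

namespace VertexOperatorAlgebra

variable {V : Type*} [AddCommGroup V] [Module ℂ V] (A : VertexOperatorAlgebra V)
  {T : Module.End ℂ V} (hT : LocallyFiniteOp T)

theorem twMode_mem {S : Submodule ℂ V} {u v : V}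
    (h : ∀ (j : ℕ) (n : ℤ), A.mode n ((T ^ j) u) v ∈ S) (p : ℤ) : A.twMode hT p u v ∈ S := by
  rw [twMode_apply]
  exact finsum_induction (· ∈ S) S.zero_mem (fun _ _ => S.add_mem)
    fun j => S.smul_mem _ (h j _)

theorem twCoeff_mem {S : Submodule ℂ V} {u v : V}
    (h : ∀ (j : ℕ) (n : ℤ), A.mode n ((T ^ j) u) v ∈ S) (k : ℤ) : A.twCoeff hT k u v ∈ S := by
  rw [twCoeff_apply]
  exact finsum_induction (· ∈ S) S.zero_mem (fun _ _ => S.add_mem)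
    fun p => S.smul_mem _ (A.twMode_mem hT h p)

end VertexOperatorAlgebra

namespace VertexOperatorAlgebra.Automorphism

variable {V : Type*} [AddCommGroup V] [Module ℂ V] {A : VertexOperatorAlgebra V}
  (g : A.Automorphism)

/-- The coefficient of `yᵏ` in `Y((1+y)^{𝓛 - L(0) + 𝓝} u, log(1+y)/(2πi)) v`, as a bilinear map; for
`k = 0` this is the product `u •_g v`. -/
def coeffMap (k : ℤ) : V →ₗ[ℂ] V →ₗ[ℂ] V := A.twCoeff g.locallyFiniteOp_twOp k

/-- The residue `Res_x Y(e^{2πix(𝓛 - L(0) + 𝓝)} u, x) v`, as a bilinear map. -/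
def resMap : V →ₗ[ℂ] V →ₗ[ℂ] V := A.twMode g.locallyFiniteOp_twOp 0

theorem twistedCoeff_eq (u v : V) (k : ℤ) : g.twistedCoeff u v k = g.coeffMap k u v :=
  A.coeffY_onePlusPow g.locallyFiniteOp_twOp u v k

theorem bullet_eq (u v : V) : g.bullet u v = g.coeffMap 0 u v := g.twistedCoeff_eq u v 0

theorem coeffMap_vacuum_left (v : V) : g.coeffMap 0 A.vacuum v = v :=
  A.twCoeff_vacuum_left _ (g.twOp_eq_zero_of_fixed g.map_vacuum) v

theorem coeffMap_vacuum_right (u : V) : g.coeffMap 0 u A.vacuum = u :=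
  A.twCoeff_vacuum_right _ u

theorem degreeOp_apply_of_mem_imagPart {x : V} (hx : x ∈ g.imagPart) :
    (A.L 0 - g.ellOp + g.weightOp) x = 0 := by
  refine g.imagPart_induction (P := fun x => (A.L 0 - g.ellOp + g.weightOp) x = 0)
    (fun a ha x hx => ?_) (fun x y hx hy => by rw [map_add, hx, hy, add_zero]) hx
  have ha' : 0 ≤ a.re ∧ a.re < 1 := by simp [ha]
  rw [ellOp, sub_add_cancel_left, LinearMap.add_apply, LinearMap.neg_apply, weightOp,
    g.scalarOp_apply _ ⟨a, ha'⟩ hx, g.scalarOp_apply _ ⟨a, ha'⟩ hx, if_pos ha, neg_add_cancel]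

theorem degreeOp_apply_of_mem_nonimagPart {x : V} (hx : x ∈ g.nonimagPart) :
    (A.L 0 - g.ellOp + g.weightOp) x = x := by
  refine g.nonimagPart_induction (P := fun x => (A.L 0 - g.ellOp + g.weightOp) x = x)
    (fun a ha ha' x hx => ?_) (fun x y hx hy => by rw [map_add, hx, hy]) hx
  rw [ellOp, sub_add_cancel_left, LinearMap.add_apply, LinearMap.neg_apply, weightOp,
    g.scalarOp_apply _ ⟨a, ha.le, ha'⟩ hx, g.scalarOp_apply _ ⟨a, ha.le, ha'⟩ hx, if_neg ha.ne']
  module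

theorem coeffMap_mem_tildeO_of_nonimagPart {u : V} (hu : u ∈ g.nonimagPart) (v : V) {k : ℤ}
    (hk : 0 ≤ k) : g.coeffMap k u v ∈ g.tildeO := by
  refine Submodule.subset_span ⟨k + 2, 1, u, v, by omega, ?_, ?_⟩
  · rw [g.degreeOp_apply_of_mem_nonimagPart hu, Int.cast_one, one_smul]
  · rw [twistedCoeff_eq, show k + 2 - 1 - 1 = k by ring]

theorem coeffMap_mem_tildeO {k : ℤ} (hk : 0 < k) (u v : V) : g.coeffMap k u v ∈ g.tildeO := by
  obtain ⟨x, hx, y, hy, rfl⟩ := g.exists_add_eq u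
  rw [map_add, LinearMap.add_apply]
  refine add_mem (Submodule.subset_span ⟨k + 1, 0, x, v, by omega, ?_, ?_⟩)
    (g.coeffMap_mem_tildeO_of_nonimagPart hy v hk.le)
  · rw [g.degreeOp_apply_of_mem_imagPart hx, Int.cast_zero, zero_smul]
  · rw [twistedCoeff_eq, show k + 1 - 0 - 1 = k by ring]

/-- `Õ_g(V)` is spanned by the coefficients of positive degree and, for first factors without
imaginary weights, also those of degree zero. -/
theorem tildeO_le {S : Submodule ℂ V}
    (h₀ : ∀ (k : ℤ) (u v : V), 0 < k → g.coeffMap k u v ∈ S)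
    (h₁ : ∀ (k : ℤ), ∀ u ∈ g.nonimagPart, ∀ v : V, 0 ≤ k → g.coeffMap k u v ∈ S) :
    g.tildeO ≤ S := by
  refine Submodule.span_le.2 ?_
  rintro _ ⟨n, d, u, v, hn, hd, rfl⟩
  rw [SetLike.mem_coe, twistedCoeff_eq]
  obtain ⟨x, hx, y, hy, rfl⟩ := g.exists_add_eq u
  rw [map_add, g.degreeOp_apply_of_mem_imagPart hx, g.degreeOp_apply_of_mem_nonimagPart hy,
    zero_add] at hd
  have hd' := congrArg (A.L 0 - g.ellOp + g.weightOp) hd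
  rw [map_smul, map_add, g.degreeOp_apply_of_mem_imagPart hx,
    g.degreeOp_apply_of_mem_nonimagPart hy, zero_add] at hd'
  -- an eigenvector lies in one of the two summands
  by_cases hd1 : d = 1
  · subst hd1
    rw [Int.cast_one, one_smul] at hd
    rw [← hd]
    exact h₁ _ y hy v (by omega)
  · have hy0 : y = 0 := by
      have h2 : ((1 : ℂ) - d) • y = 0 := by rw [sub_smul, one_smul, ← hd', sub_self]
      refine (smul_eq_zero.1 h2).resolve_left fun h => hd1 ?_
      exact_mod_cast (sub_eq_zero.1 h).symm
    by_cases hd0 : d = 0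
    · exact h₀ _ _ v (by omega)
    · rw [hy0, add_zero] at hd ⊢
      have hx0 : x = 0 := (smul_eq_zero.1 hd.symm).resolve_left (by exact_mod_cast hd0)
      rw [hx0, map_zero, LinearMap.zero_apply]
      exact S.zero_mem

theorem nonimagPart_le_tildeO : g.nonimagPart ≤ g.tildeO := fun v hv => by
  have := g.coeffMap_mem_tildeO_of_nonimagPart hv A.vacuum le_rfl
  rwa [coeffMap_vacuum_right] at this

theorem resMap_mem_nonimagPart {u v : V} (hu : u ∈ g.imagPart) (hv : v ∈ g.nonimagPart) :
    g.resMap u v ∈ g.nonimagPart :=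
  A.twMode_mem _ (fun j n => g.mode_mem_nonimagPart
    (pow_apply_mem_of_stable g.twOp_mem_imagPart j hu) hv n) 0

theorem coeffMap_mem_nonimagPart {u v : V} (hu : u ∈ g.imagPart) (hv : v ∈ g.nonimagPart) (k : ℤ) :
    g.coeffMap k u v ∈ g.nonimagPart :=
  A.twCoeff_mem _ (fun j n => g.mode_mem_nonimagPart
    (pow_apply_mem_of_stable g.twOp_mem_imagPart j hu) hv n) k

theorem resMap_coeffMap {u : V} (hu : u ∈ g.imagPart) (v w : V) (k : ℤ) :
    g.resMap u (g.coeffMap k v w) =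
      g.coeffMap k (g.resMap u v) w + g.coeffMap k v (g.resMap u w) :=
  A.twMode_zero_twCoeff _ g.twOp_mem_imagPart g.twOp_mode hu v w k

theorem coeffMap_commutator_mem {u : V} (hu : u ∈ g.imagPart) (v w : V) {k : ℤ} (hk : 0 ≤ k) :
    g.coeffMap 0 u (g.coeffMap k v w) - g.coeffMap k v (g.coeffMap 0 u w) -
      kappa • g.coeffMap k (g.resMap u v) w ∈ g.tildeO :=
  A.twCoeff_zero_commutator_mem _ g.twOp_mem_imagPart g.twOp_mode hu v w k
    fun _ hk' x y => g.coeffMap_mem_tildeO (hk.trans_lt hk') x y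

/-- The commutator of two elements, the first of imaginary weights, modulo `Õ_g(V)`. -/
theorem commutator_mem {u : V} (hu : u ∈ g.imagPart) (v : V) :
    g.coeffMap 0 u v - g.coeffMap 0 v u - kappa • g.resMap u v ∈ g.tildeO := by
  have h := g.coeffMap_commutator_mem hu v A.vacuum le_rfl
  rwa [coeffMap_vacuum_right, coeffMap_vacuum_right, coeffMap_vacuum_right] at h

theorem coeffMap_mem_tildeO_right (u : V) {x : V} (hx : x ∈ g.tildeO) :
    g.coeffMap 0 u x ∈ g.tildeO := by
  obtain ⟨u₀, hu₀, u₁, hu₁, rfl⟩ := g.exists_add_eq u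
  rw [map_add, LinearMap.add_apply]
  refine add_mem ?_ (g.coeffMap_mem_tildeO_of_nonimagPart hu₁ x le_rfl)
  have key : ∀ (k : ℤ) (v w : V), 0 ≤ k → (∀ w' : V, g.coeffMap k v w' ∈ g.tildeO) →
      g.coeffMap k (g.resMap u₀ v) w ∈ g.tildeO →
      g.coeffMap k v w ∈ g.tildeO.comap (g.coeffMap 0 u₀) := by
    intro k v w hk h1 h2
    have := add_mem (add_mem (g.coeffMap_commutator_mem hu₀ v w hk)
      (g.tildeO.smul_mem kappa h2)) (h1 (g.coeffMap 0 u₀ w))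
    rwa [sub_add_cancel, sub_add_cancel] at this
  refine g.tildeO_le (S := g.tildeO.comap (g.coeffMap 0 u₀)) (fun k v w hk => ?_)
    (fun k v hv w hk => ?_) hx
  · exact key k v w hk.le (fun w' => g.coeffMap_mem_tildeO hk v w') (g.coeffMap_mem_tildeO hk _ w)
  · exact key k v w hk (fun w' => g.coeffMap_mem_tildeO_of_nonimagPart hv w' hk)
      (g.coeffMap_mem_tildeO_of_nonimagPart (g.resMap_mem_nonimagPart hu₀ hv) w hk)

theorem resMap_mem_tildeO {u : V} (hu : u ∈ g.imagPart) {x : V} (hx : x ∈ g.tildeO) :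
    g.resMap u x ∈ g.tildeO := by
  refine g.tildeO_le (S := g.tildeO.comap (g.resMap u)) (fun k v w hk => ?_)
    (fun k v hv w hk => ?_) hx
  · rw [Submodule.mem_comap, g.resMap_coeffMap hu]
    exact add_mem (g.coeffMap_mem_tildeO hk _ _) (g.coeffMap_mem_tildeO hk _ _)
  · rw [Submodule.mem_comap, g.resMap_coeffMap hu]
    exact add_mem (g.coeffMap_mem_tildeO_of_nonimagPart (g.resMap_mem_nonimagPart hu hv) _ hk)
      (g.coeffMap_mem_tildeO_of_nonimagPart hv _ hk)

/-- `Õ_g(V)` is stable under multiplication from the right. For `w` of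
imaginary weights, right multiplication by `w` is left multiplication by `w` up to the residue
operator of `w`, and both preserve `Õ_g(V)`. -/
theorem coeffMap_mem_tildeO_left {x : V} (hx : x ∈ g.tildeO) (w : V) :
    g.coeffMap 0 x w ∈ g.tildeO := by
  obtain ⟨w₀, hw₀, w₁, hw₁, rfl⟩ := g.exists_add_eq w
  rw [map_add]
  refine add_mem ?_ ?_
  · have := sub_mem (sub_mem (g.coeffMap_mem_tildeO_right w₀ hx)
      (g.tildeO.smul_mem kappa (g.resMap_mem_tildeO hw₀ hx))) (g.commutator_mem hw₀ x)
    convert this using 1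
    abel
  · obtain ⟨x₀, hx₀, x₁, hx₁, rfl⟩ := g.exists_add_eq x
    rw [map_add, LinearMap.add_apply]
    exact add_mem (g.nonimagPart_le_tildeO (g.coeffMap_mem_nonimagPart hx₀ hw₁ 0))
      (g.coeffMap_mem_tildeO_of_nonimagPart hx₁ _ le_rfl)

/-- Associativity modulo `Õ_g(V)`: for `w` of imaginary weights, right multiplication by `w` is
`w • - 2πi Res_w`, and its commutator with the left multiplication by `u` vanishes because
`[w •, u •] ≡ 2πi (Res_w u) • ≡ 2πi [Res_w, u •]`. -/
theorem associator_mem (u v w : V) :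
    g.coeffMap 0 (g.coeffMap 0 u v) w - g.coeffMap 0 u (g.coeffMap 0 v w) ∈ g.tildeO := by
  obtain ⟨w₀, hw₀, w₁, hw₁, rfl⟩ := g.exists_add_eq w
  have hw₁' := g.nonimagPart_le_tildeO hw₁
  have h1 := sub_mem (g.coeffMap_mem_tildeO_right (g.coeffMap 0 u v) hw₁')
    (g.coeffMap_mem_tildeO_right u (g.coeffMap_mem_tildeO_right v hw₁'))
  have h2 := g.commutator_mem hw₀ (g.coeffMap 0 u v)
  have h3 := g.coeffMap_mem_tildeO_right u (g.commutator_mem hw₀ v)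
  have h4 := g.coeffMap_commutator_mem hw₀ u v le_rfl
  rw [g.resMap_coeffMap hw₀] at h2
  rw [map_sub, map_sub, map_smul] at h3
  have h5 := add_mem h1 (add_mem (sub_mem h3 h2) h4)
  convert h5 using 1
  simp only [map_add, smul_add]
  abel

/-- The product on `Ã_g(V)`. -/
def tildeMul : g.TildeA →ₗ[ℂ] g.TildeA →ₗ[ℂ] g.TildeA :=
  g.tildeO.liftQ
    { toFun := fun u => g.tildeO.mapQ g.tildeO (g.coeffMap 0 u)
        fun _ hx => g.coeffMap_mem_tildeO_right u hx
      map_add' := fun u v => by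
        ext w
        simp
      map_smul' := fun c u => by
        ext w
        simp }
    (fun x hx => by
      rw [LinearMap.mem_ker]
      ext w
      exact (Submodule.Quotient.mk_eq_zero _).2 (g.coeffMap_mem_tildeO_left hx w))

theorem tildeMul_mkQ (u v : V) :
    g.tildeMul (g.tildeO.mkQ u) (g.tildeO.mkQ v) = g.tildeO.mkQ (g.coeffMap 0 u v) := rfl

theorem derivative_mem_tildeO (u v : V) :
    g.coeffMap 0 (A.mode 0 A.conformal u + kappa • g.twOp u) v ∈ g.tildeO := by
  have h := A.twCoeff_derivative g.locallyFiniteOp_twOp (g.twOp_mode_conformal 0) 0 u v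
  rw [coeffMap, h, Int.cast_zero, zero_smul, add_zero]
  exact g.tildeO.smul_mem _ (g.tildeO.smul_mem _ (g.coeffMap_mem_tildeO (by norm_num) u v))

theorem twOp_pow_apply {a : ℂ} (ha : a.re = 0) {u : V} (hu : u ∈ g.genSpace a) (j : ℕ) :
    (g.twOp ^ j) u = ((g.nilOp + a • (1 : Module.End ℂ V)) ^ j) u := by
  have hS : ∀ x ∈ g.genSpace a, g.twOp x ∈ g.genSpace a := fun x hx =>
    g.twOp_mem_genSpace ⟨a, by simp [ha]⟩ hx
  induction j with
  | zero => rfl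
  | succ j ih =>
    rw [pow_succ', pow_succ', Module.End.mul_apply, Module.End.mul_apply, ← ih,
      g.twOp_apply_of_re_eq_zero ha (pow_apply_mem_of_stable hS j hu)]
    simp [add_comm]

theorem resMap_eq_finsum {a : ℂ} (ha : a.re = 0) {u : V} (hu : u ∈ g.genSpace a) (v : V) :
    g.resMap u v = ∑ᶠ i : ℕ, expKappa i •
      vertexMode A.Y (((g.nilOp + a • (1 : Module.End ℂ V)) ^ i) u) (i : ℤ) v := by
  rw [resMap, twMode_apply]
  refine finsum_congr fun i => ?_
  rw [g.twOp_pow_apply ha hu, zero_add, vertexMode_eq_mode]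

theorem resExp_eq {a : ℂ} (ha : a.re = 0) {u : V} (hu : u ∈ g.genSpace a) (v : V) :
    g.resExp a u v = g.resMap u v := by
  obtain ⟨M, hM⟩ := A.exists_mode_pow_eq_zero g.locallyFiniteOp_twOp u v
  have hexp : ∀ j : ℕ, expCoeff ((2 * Real.pi * Complex.I : ℂ) •
      (a • (1 : Module.End ℂ V) + g.nilOp)) u j = expKappa j • (g.twOp ^ j) u := by
    intro j
    rw [expCoeff, smul_pow, LinearMap.smul_apply, smul_smul, g.twOp_pow_apply ha hu, add_comm,
      expKappa, div_eq_inv_mul]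
    rfl
  have hsingle : ∀ (n : ℤ) (j : ℕ),
      ((HahnSeries.single (1 : ℤ) (1 : ℂ) : LaurentSeries ℂ) ^ (-n - 1)).coeff (-1 - j) =
        if n = j then 1 else 0 := by
    intro n j
    rw [← RatFunc.single_zpow, HahnSeries.coeff_single]
    congr 1
    exact propext ⟨fun h => by omega, fun h => by omega⟩
  rw [resMap, A.twMode_eq_sum _ (M := M) fun j hj => hM j _ (by omega), resExp, coeffY]
  simp only [hexp, hsingle, vertexMode_eq_mode]
  rw [finsum_eq_sum_of_support_subset (s := (Finset.range M).image fun j : ℕ => ((j : ℤ), j)),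
    Finset.sum_image]
  · refine Finset.sum_congr rfl fun j _ => ?_
    rw [if_pos rfl, one_smul, map_smul, LinearMap.smul_apply, zero_add]
  · intro i _ j _ h
    exact (Prod.ext_iff.1 h).2
  · rintro ⟨n, j⟩ hx
    by_contra h
    refine hx ?_
    simp only
    split_ifs with hnj
    · have hj : M ≤ j := by
        by_contra hj
        refine h ?_
        rw [Finset.mem_coe, Finset.mem_image]
        exact ⟨j, by simpa using hj, by rw [hnj]⟩
      rw [map_smul, LinearMap.smul_apply, hM j _ (by omega), smul_zero, smul_zero]
    · rw [zero_smul]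

theorem conformal_commutator_mem (v : V) :
    g.coeffMap 0 A.conformal v - g.coeffMap 0 v A.conformal + kappa ^ 2 • g.twOp v ∈ g.tildeO := by
  have h1 := g.commutator_mem g.conformal_mem_imagPart v
  have h2 := g.derivative_mem_tildeO v A.vacuum
  have h3 : g.resMap A.conformal v = A.mode 0 A.conformal v := by
    rw [resMap, A.twMode_eq_sum _ (M := 1)]
    · simp [expKappa]
    · intro j hj
      obtain ⟨j, rfl⟩ := Nat.exists_eq_add_of_le' hj
      rw [pow_succ, Module.End.mul_apply, g.twOp_eq_zero_of_fixed g.map_conformal]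
      simp
  rw [coeffMap_vacuum_right] at h2
  rw [h3] at h1
  convert add_mem h1 (g.tildeO.smul_mem kappa h2) using 1
  rw [smul_add, smul_smul, pow_two]
  abel

theorem exists_pow_bracket_eq_zero {b : ℂ} (hb : b.re = 0) {v : V} (hv : v ∈ g.genSpace b) :
    ∃ k : ℕ, (((g.tildeMul (g.tildeO.mkQ A.conformal) - g.tildeMul.flip (g.tildeO.mkQ A.conformal)
      + (kappa ^ 2 * b) • (1 : Module.End ℂ g.TildeA)) : Module.End ℂ g.TildeA) ^ k)
        (g.tildeO.mkQ v) = 0 := by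
  set E : Module.End ℂ g.TildeA :=
    g.tildeMul (g.tildeO.mkQ A.conformal) - g.tildeMul.flip (g.tildeO.mkQ A.conformal)
      + (kappa ^ 2 * b) • (1 : Module.End ℂ g.TildeA) with hE
  have h1 : ∀ x ∈ g.genSpace b, E (g.tildeO.mkQ x) = g.tildeO.mkQ ((-kappa ^ 2) • g.nilOp x) := by
    intro x hx
    have h := g.conformal_commutator_mem x
    rw [← Submodule.Quotient.mk_eq_zero, ← Submodule.mkQ_apply, g.twOp_apply_of_re_eq_zero hb hx] at h
    rw [hE, LinearMap.add_apply, LinearMap.sub_apply, LinearMap.flip_apply, tildeMul_mkQ,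
      tildeMul_mkQ, LinearMap.smul_apply, Module.End.one_apply, ← map_sub, ← map_smul, ← map_add,
      ← sub_eq_zero, ← map_sub, ← h]
    congr 1
    module
  have h2 : ∀ (k : ℕ), ∀ x ∈ g.genSpace b,
      (E ^ k) (g.tildeO.mkQ x) = g.tildeO.mkQ ((-kappa ^ 2) ^ k • (g.nilOp ^ k) x) := by
    intro k
    induction k with
    | zero => intro x _; simp
    | succ k ih =>
      intro x hx
      rw [pow_succ, Module.End.mul_apply, h1 x hx, ih _ ((g.genSpace b).smul_mem _
        (g.nilOp_mem_genSpace hx)), map_smul (g.nilOp ^ k), smul_smul, ← pow_succ, pow_succ g.nilOp,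
        Module.End.mul_apply]
  obtain ⟨k, hk⟩ := g.exists_nilOp_pow_eq_zero v
  exact ⟨k, by rw [h2 k v hv, hk, smul_zero, map_zero]⟩

end VertexOperatorAlgebra.Automorphism

end

theorem theorem4p1 {V : Type*} [AddCommGroup V] [Module ℂ V] (A : VertexOperatorAlgebra V)
    (g : A.Automorphism) :
    ∃ μ : g.TildeA →ₗ[ℂ] g.TildeA →ₗ[ℂ] g.TildeA,
      -- the product of `V` induces the product `μ` on the quotient
      (∀ u v : V, μ (g.tildeO.mkQ u) (g.tildeO.mkQ v) = g.tildeO.mkQ (g.bullet u v)) ∧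
      -- the quotient is an associative algebra whose identity is the class of the vacuum
      (∀ x y z : g.TildeA, μ (μ x y) z = μ x (μ y z)) ∧
      (∀ x : g.TildeA, μ (g.tildeO.mkQ A.vacuum) x = x) ∧
      (∀ x : g.TildeA, μ x (g.tildeO.mkQ A.vacuum) = x) ∧
      -- `((L(-1) + 2πi(a + 𝓝))u) •_g v ∈ Õ_g(V)`
      (∀ a ∈ g.weights, a.re = 0 → ∀ u ∈ g.genSpace a, ∀ v : V,
        g.bullet (A.L (-1) u + (2 * Real.pi * Complex.I : ℂ) • (a • u + g.nilOp u)) v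
          ∈ g.tildeO) ∧
      -- the commutator formula
      (∀ a ∈ g.weights, ∀ b ∈ g.weights, a.re = 0 → b.re = 0 →
        ∀ u ∈ g.genSpace a, ∀ v ∈ g.genSpace b,
          g.bullet u v - g.bullet v u - (2 * Real.pi * Complex.I : ℂ) • g.resExp a u v
            ∈ g.tildeO ∧
          (2 * Real.pi * Complex.I : ℂ) • g.resExp a u v =
            (2 * Real.pi * Complex.I : ℂ) • ∑ᶠ i : ℕ,
              ((2 * Real.pi * Complex.I : ℂ) ^ i / (i.factorial : ℂ)) •
                vertexMode A.Y (((g.nilOp + a • (1 : Module.End ℂ V)) ^ i) u) (i : ℤ) v) ∧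
      -- bracket with the conformal element
      (∀ b ∈ g.weights, b.re = 0 → ∀ v ∈ g.genSpace b,
        g.bullet A.conformal v - g.bullet v A.conformal
          + (2 * Real.pi * Complex.I : ℂ) ^ 2 • (b • v + g.nilOp v) ∈ g.tildeO) ∧
      -- repeated brackets with the conformal element, on `V^{[b + ℤ]}` with `b` imaginary
      (∀ b ∈ g.weights, b.re = 0 → ∀ v ∈ g.genSpace b, ∃ k : ℕ,
        (((μ (g.tildeO.mkQ A.conformal) - μ.flip (g.tildeO.mkQ A.conformal)
          + ((2 * Real.pi * Complex.I : ℂ) ^ 2 * b) • (1 : Module.End ℂ g.TildeA)) :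
            Module.End ℂ g.TildeA) ^ k) (g.tildeO.mkQ v) = 0) ∧
      -- repeated brackets vanish off the nonzero imaginary `g`-weights
      (∀ v ∈ ⨆ b ∈ {b : ℂ | b ∈ g.weights ∧ (b.re = 0 → b = 0)}, g.genSpace b, ∃ k : ℕ,
        ((μ (g.tildeO.mkQ A.conformal) - μ.flip (g.tildeO.mkQ A.conformal) :
            Module.End ℂ g.TildeA) ^ k) (g.tildeO.mkQ v) = 0) := by
  refine ⟨g.tildeMul, fun u v => ?_, ?_, ?_, ?_, ?_, ?_, ?_, ?_, ?_⟩
  · rw [g.tildeMul_mkQ, g.bullet_eq]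
  · intro x y z
    obtain ⟨u, rfl⟩ := g.tildeO.mkQ_surjective x
    obtain ⟨v, rfl⟩ := g.tildeO.mkQ_surjective y
    obtain ⟨w, rfl⟩ := g.tildeO.mkQ_surjective z
    rw [g.tildeMul_mkQ, g.tildeMul_mkQ, g.tildeMul_mkQ, g.tildeMul_mkQ, ← sub_eq_zero, ← map_sub,
      Submodule.mkQ_apply, Submodule.Quotient.mk_eq_zero]
    exact g.associator_mem u v w
  · intro x
    obtain ⟨u, rfl⟩ := g.tildeO.mkQ_surjective x
    rw [g.tildeMul_mkQ, g.coeffMap_vacuum_left]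
  · intro x
    obtain ⟨u, rfl⟩ := g.tildeO.mkQ_surjective x
    rw [g.tildeMul_mkQ, g.coeffMap_vacuum_right]
  · intro a _ ha u hu v
    have h := g.derivative_mem_tildeO u v
    rw [g.twOp_apply_of_re_eq_zero ha hu] at h
    rw [g.bullet_eq]
    exact h
  · intro a _ b _ ha _ u hu v _
    rw [g.resExp_eq ha hu, g.bullet_eq, g.bullet_eq]
    exact ⟨g.commutator_mem (g.genSpace_le_imagPart ha hu) v,
      congrArg _ (g.resMap_eq_finsum ha hu v)⟩
  · intro b _ hb v hv
    have h := g.conformal_commutator_mem v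
    rw [g.twOp_apply_of_re_eq_zero hb hv] at h
    rw [g.bullet_eq, g.bullet_eq]
    exact h
  · intro b _ hb v hv
    exact g.exists_pow_bracket_eq_zero hb hv
  · intro v hv
    set D : Module.End ℂ g.TildeA := g.tildeMul (g.tildeO.mkQ A.conformal) -
      g.tildeMul.flip (g.tildeO.mkQ A.conformal) with hD
    have hle : ⨆ b ∈ {b : ℂ | b ∈ g.weights ∧ (b.re = 0 → b = 0)}, g.genSpace b ≤
        (Module.End.maxGenEigenspace D 0).comap g.tildeO.mkQ := by
      refine iSup₂_le fun b hb x hx => ?_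
      rw [Submodule.mem_comap, Module.End.mem_maxGenEigenspace]
      rcases hb.1.1.eq_or_lt with h0 | h0
      · obtain rfl := hb.2 h0.symm
        obtain ⟨k, hk⟩ := g.exists_pow_bracket_eq_zero Complex.zero_re hx
        rw [mul_zero, zero_smul, add_zero] at hk
        exact ⟨k, by rw [zero_smul, sub_zero]; exact hk⟩
      · refine ⟨0, ?_⟩
        rw [pow_zero, Module.End.one_apply, Submodule.mkQ_apply, Submodule.Quotient.mk_eq_zero]
        exact g.nonimagPart_le_tildeO (g.genSpace_le_nonimagPart h0 hb.1.2.1 hx)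
    have h := hle hv
    rw [Submodule.mem_comap, Module.End.mem_maxGenEigenspace] at h
    simpa using h
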